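/- **Local Lipschitz dependence of RDE solutions on the data.** For $p>0$, an interval $I\subset\mathbb R$ and a non-negative two-parameter function $\chi$ put $V^p\chi_I=\sup\big(\sum_{i<n}\chi(\pi_i,\pi_{i+1})^p\big)^{1/p}$, the supremum over all finite sequences $\pi_0<\dots<\pi_n$ in $I$. For a path $f$ use $\chi(s,t)=|f_t-f_s|$, and for a two-parameter function $A$ use $\chi(s,t)=|A_{s,t}|$. Let $r\in[2,3)$, let $E$ be a finite-dimensional real normed space (for instance $\mathbb R^n$) with a norm on $E\otimes E$ such that $|x\otimes y|=|x||y|$, and let $F$ be a real Banach space (for instance $\mathbb R^d$). An $r$-rough path $\mathbf X=(X,\mathbb X)$ on $[0,T]$ consists of $X_{s,t}\in E$ and $\mathbb X_{s,t}\in E\otimes E$ with $V^rX_{[0,T]}<\infty$, $V^{r/2}\mathbb X_{[0,T]}<\infty$ and, for $0\le s\le u\le t\le T$, $X_{s,t}=X_{s,u}+X_{u,t}$ and $\mathbb X_{s,t}=\mathbb X_{s,u}+\mathbb X_{u,t}+X_{s,u}\otimes X_{u,t}$ (jumps are allowed). An $\mathbf X$-controlled path $\mathbf Y=(Y,Y')$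 consists of $Y:[0,T]\to F$ and $Y':[0,T]\to L(E,F)$ with $V^rY'_{[0,T]}<\infty$ and $V^{r/2}R^{\mathbf Y,\mathbf X}_{[0,T]}<\infty$, where $R^{\mathbf Y,\mathbf X}_{s,t}=Y_t-Y_s-Y'_sX_{s,t}$. For $\phi:F\to L(E,F)$, a controlled path $\mathbf Y$ is a solution of the RDE driven by $\mathbf X$ with initial datum $y_0$ if for all $t\in[0,T]$ $$Y_t=y_0+\int_0^t\phi(\mathbf Y)\,d\mathbf X,\qquad Y'_t=\phi(Y_t),$$ where $\phi(\mathbf Y)=(\phi(Y),D\phi(Y)Y')$, and the rough integral is the limit, along partitions of $[0,t]$ directed by refinement, of the sums $\sum_i \big(\phi(Y_{\pi_i})X_{\pi_i,\pi_{i+1}}+D\phi(Y_{\pi_i})Y'_{\pi_i}\mathbb X_{\pi_i,\pi_{i+1}}\big)$. **Theorem.** Let $\phi\in C^{2,1}_b(F,L(E,F))$, i.e. $\phi$ is twice differentiable, $\phi,D\phi,D^2\phi$ are bounded and $D^2\phi$ is Lipschitz. There are $\epsilon>0$ and finite constants $c_1,c_2$, depending only on $\phi$ and $r$ (and the normed spaces),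 such that the following holds for all $T\ge0$. Let $\mathbf X,\tilde{\mathbf X}$ be $r$-rough paths on $[0,T]$ with $V^rX,\ V^{r/2}\mathbb X,\ V^r\tilde X,\ V^{r/2}\tilde{\mathbb X}<\epsilon$ on $[0,T]$, and let $\mathbf Y,\tilde{\mathbf Y}$ be solutions of the RDE driven by $\mathbf X,\tilde{\mathbf X}$ with initial data $y_0,\tilde y_0\in F$. Write $\Delta y_0=y_0-\tilde y_0$, $\Delta X=X-\tilde X$, $\Delta\mathbb X=\mathbb X-\tilde{\mathbb X}$, $\Delta Y=Y-\tilde Y$, $\Delta R^{\mathbf Y,\mathbf X}=R^{\mathbf Y,\mathbf X}-R^{\tilde{\mathbf Y},\tilde{\mathbf X}}$ and $\gamma=|\Delta y_0|+V^r(\Delta X)_{[0,T]}+V^{r/2}(\Delta\mathbb X)_{[0,T]}$. Then for every interval $I\subset[0,T]$ $$V^r(\Delta Y)_I\le c_1\Big(\big(V^rX_I+V^{r/2}\mathbb X_I+V^{r/2}\tilde{\mathbb X}_I\big)\gamma+V^r(\Delta X)_I+V^{r/2}(\Delta\mathbb X)_I\Big),$$ $$V^{r/2}(\Delta R^{\mathbf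 Y,\mathbf X})_I\le c_2\Big(\big((V^rX_I)^2+V^rX_I\,V^r\tilde X_I+V^{r/2}\mathbb X_I+V^{r/2}\tilde{\mathbb X}_I\big)\gamma+\big(V^rX_I+V^r\tilde X_I+V^{r/2}\mathbb X_I+V^{r/2}\tilde{\mathbb X}_I\big)V^r(\Delta X)_I+V^{r/2}(\Delta\mathbb X)_I\Big).$$ -/

import Mathlib

open scoped NNReal ENNReal TensorProduct

noncomputable section

namespace RDE

/-- The `p`-variation over `I` of a two-parameter function `χ`: the supremum of
`(∑ χ(π_i, π_{i+1}) ^ p) ^ (1 / p)` over all finite increasing sequences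
`π_0 < ⋯ < π_n` in `I`, with value in `[0, ∞]`. -/
def variation (p : ℝ) (χ : ℝ → ℝ → ℝ≥0∞) (I : Set ℝ) : ℝ≥0∞ :=
  ⨆ (n : ℕ) (u : ℕ → ℝ) (_ : StrictMonoOn u (Set.Iic n)) (_ : ∀ i ≤ n, u i ∈ I),
    (∑ i ∈ Finset.range n, χ (u i) (u (i + 1)) ^ p) ^ (1 / p)

/-- The `p`-variation of a one-parameter path. -/
def pathVariation {G : Type*} [NormedAddCommGroup G] (p : ℝ) (f : ℝ → G) (I : Set ℝ) : ℝ≥0∞ :=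
  variation p (fun s t => ‖f t - f s‖ₑ) I

/-- The `p`-variation of a two-parameter function with values in a normed space. -/
def normVariation {G : Type*} [NormedAddCommGroup G] (p : ℝ) (A : ℝ → ℝ → G) (I : Set ℝ) : ℝ≥0∞ :=
  variation p (fun s t => ‖A s t‖ₑ) I

/-- `z` is the limit of the Riemann sums `∑ Ξ(u_i, u_{i+1})` over the partitions
`a = u_0 < ⋯ < u_n = b` of `[a, b]`, directed by refinement. -/
def IsSewingLimit {G : Type*} [NormedAddCommGroup G] (Ξ : ℝ → ℝ → G) (a b : ℝ) (z : G) : Prop :=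
  ∀ ε > (0 : ℝ), ∃ P : Finset ℝ, (P : Set ℝ) ⊆ Set.Icc a b ∧
    ∀ (n : ℕ) (u : ℕ → ℝ), StrictMonoOn u (Set.Iic n) → u 0 = a → u n = b →
      (P : Set ℝ) ⊆ u '' Set.Iic n →
        ‖∑ i ∈ Finset.range n, Ξ (u i) (u (i + 1)) - z‖ < ε

variable {E : Type*} [NormedAddCommGroup E] [NormedSpace ℝ E]
  {F : Type*} [NormedAddCommGroup F] [NormedSpace ℝ F]

variable (E) in
/-- A norm on `E ⊗ E` that is compatible with the norm of `E`: `|x ⊗ y| = |x| |y|`. -/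
structure CompatibleNorm where
  toSeminorm : Seminorm ℝ (E ⊗[ℝ] E)
  eq_zero_of_norm_eq_zero : ∀ ξ, toSeminorm ξ = 0 → ξ = 0
  norm_tmul : ∀ x y : E, toSeminorm (x ⊗ₜ[ℝ] y) = ‖x‖ * ‖y‖

/-- The `p`-variation of a two-parameter function with values in `E ⊗ E`, for the norm `N`. -/
def tensorVariation (N : CompatibleNorm E) (p : ℝ) (A : ℝ → ℝ → E ⊗[ℝ] E) (I : Set ℝ) : ℝ≥0∞ :=
  variation p (fun s t => ENNReal.ofReal (N.toSeminorm (A s t))) I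

/-- A level-2 `r`-rough path `(X, 𝕏)` on `[0, T]`; only the values at `0 ≤ s ≤ t ≤ T` matter. -/
structure RoughPath (N : CompatibleNorm E) (r T : ℝ) where
  X : ℝ → ℝ → E
  XX : ℝ → ℝ → E ⊗[ℝ] E
  variation_X : normVariation r X (Set.Icc 0 T) < ∞
  variation_XX : tensorVariation N (r / 2) XX (Set.Icc 0 T) < ∞
  X_add : ∀ s u t, 0 ≤ s → s ≤ u → u ≤ t → t ≤ T → X s t = X s u + X u t
  chen : ∀ s u t, 0 ≤ s → s ≤ u → u ≤ t → t ≤ T →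
    XX s t = XX s u + XX u t + X s u ⊗ₜ[ℝ] X u t

/-- The remainder `R_{s,t} = Y_t - Y_s - Y'_s X_{s,t}`. -/
def remainder (X : ℝ → ℝ → E) (Y : ℝ → F) (Y' : ℝ → E →L[ℝ] F) (s t : ℝ) : F :=
  Y t - Y s - Y' s (X s t)

/-- A `bX`-controlled `r`-rough path `(Y, Y')` on `[0, T]` with values in `F`. -/
structure ControlledPath {N : CompatibleNorm E} {r T : ℝ} (bX : RoughPath N r T)
    (F : Type*) [NormedAddCommGroup F] [NormedSpace ℝ F] where
  Y : ℝ → F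
  Y' : ℝ → E →L[ℝ] F
  variation_Y' : pathVariation r Y' (Set.Icc 0 T) < ∞
  variation_remainder : normVariation (r / 2) (remainder bX.X Y Y') (Set.Icc 0 T) < ∞

/-- The remainder of a controlled path. -/
def ControlledPath.R {N : CompatibleNorm E} {r T : ℝ} {bX : RoughPath N r T}
    (bY : ControlledPath bX F) : ℝ → ℝ → F :=
  remainder bX.X bY.Y bY.Y'

/-- An element of `L(E, L(E, F))` acts on `E ⊗ E` by `B (x ⊗ y) = B x y`. -/
def tensorAct (B : E →L[ℝ] E →L[ℝ] F) : E ⊗[ℝ] E →ₗ[ℝ] F :=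
  TensorProduct.lift B.toLinearMap₁₂

/-- `z` is the rough integral `∫_a^b (Z, Z') d(bX)`, the sewing of the germ
`Z_s X_{s,t} + Z'_s 𝕏_{s,t}`. -/
def IsRoughIntegral {N : CompatibleNorm E} {r T : ℝ} (bX : RoughPath N r T)
    (Z : ℝ → E →L[ℝ] F) (Z' : ℝ → E →L[ℝ] E →L[ℝ] F) (a b : ℝ) (z : F) : Prop :=
  IsSewingLimit (fun s t => Z s (bX.X s t) + tensorAct (Z' s) (bX.XX s t)) a b z

/-- The controlled path `bY` solves `Y_t = y₀ + ∫_0^t φ(bY) d(bX)`, `Y'_t = φ(Y_t)` on `[0, T]`,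
where `φ(bY) = (φ(Y), Dφ(Y) Y')`. -/
def IsSolution {N : CompatibleNorm E} {r T : ℝ} {bX : RoughPath N r T}
    (φ : F → E →L[ℝ] F) (y₀ : F) (bY : ControlledPath bX F) : Prop :=
  ∀ t ∈ Set.Icc 0 T, bY.Y' t = φ (bY.Y t) ∧
    IsRoughIntegral bX (fun s => φ (bY.Y s)) (fun s => (fderiv ℝ φ (bY.Y s)).comp (bY.Y' s))
      0 t (bY.Y t - y₀)

/-- `φ ∈ C^{2,1}_b`: `φ`, `Dφ`, `D²φ` exist and are bounded, and `D²φ` is Lipschitz. -/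
structure IsC21b {G : Type*} [NormedAddCommGroup G] [NormedSpace ℝ G] (φ : F → G) : Prop where
  contDiff : ContDiff ℝ 2 φ
  bounded : ∃ K, ∀ y, ‖φ y‖ ≤ K
  bounded_fderiv : ∃ K, ∀ y, ‖fderiv ℝ φ y‖ ≤ K
  bounded_fderiv_fderiv : ∃ K, ∀ y, ‖fderiv ℝ (fderiv ℝ φ) y‖ ≤ K
  lipschitz : ∃ K : ℝ≥0, LipschitzWith K (fderiv ℝ (fderiv ℝ φ))

end RDE

end

/-! The estimate rests on a reduction to pointwise bounds. Over a fixed interval `I`, the finitely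
many functions that occur (`X`, `𝕏`, the remainder `R`, their counterparts for the second solution,
and the differences) have finite `r`- or `r/2`-variation, so each is dominated by a power of a
control, a superadditive function. Averaging the normalised controls gives one function `h ≤ 1`
with `h ^ r` superadditive such that every function of the list is at most a constant times
its variation over `I` times `h` or `h ^ 2` (`IsGauge`, `exists_gauge`). Conversely a bound by
`c * h ^ m` bounds the `r / m`-variation by `c` (`IsGauge.variation_le`). Thus variation estimates
become Hölder-type estimates, and no continuity of the paths is needed.

The rough integral is compared with its germ by the sewing estimate
`IsSewingLimit.norm_sub_le`: if the defect of additivity of a germ is at most `D * h ^ 3`, then, as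
`r < 3`, its sewing limit differs from it by at most a constant times `D * h ^ 3`. By Chen's
relation the defect of `φ(Y_s) X_{s,t} + Dφ(Y_s) φ(Y_s) 𝕏_{s,t}` is made of the remainder of `φ(Y)`
tested on `X` and of the increment of `Dφ(Y) φ(Y)` tested on `𝕏` (`germ_sub_germ_sub_germ`). For
one solution this bounds `V^{r/2} R` by `𝕏` and the square of `X`, up to a term with
`V^{r/2} R` itself and a small factor, which is absorbed (`IsSolution.varR_le`); it matters
that the remainder of `φ(Y)` is bounded linearly in `R`.

For two solutions the defects are subtracted. Differences of increments and of Taylor remainders of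
`φ` are Lipschitz in the base point and in the increment (`FourPointLipschitz`,
`norm_taylor_sub_le`), which is where the Lipschitz continuity of `D²φ` enters. With `M` a bound for
`|ΔY|` on `I` this gives both estimates with `M` in place of `γ`, after absorbing `V^{r/2} (ΔR)`
(`variation_sub_le`). On `I = [0, T]` the resulting bound for `|ΔY|` contains the supremum of `|ΔY|`
with a small factor, hence that supremum is at most a constant times `γ`
(`norm_sub_le_of_smallData`), and inserting this bound for `M` proves the theorem on any `I`. -/

namespace RDE

/-! ### Finite chains -/

lemma exists_chain_append {n m : ℕ} {u v : ℕ → ℝ} (hu : StrictMonoOn u (Set.Iic n))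
    (hv : StrictMonoOn v (Set.Iic m)) (huv : u n = v 0) :
    ∃ z : ℕ → ℝ, StrictMonoOn z (Set.Iic (n + m)) ∧ z 0 = u 0 ∧ z (n + m) = v m ∧
      (∀ i ≤ n, z i = u i) ∧ (∀ i ≤ m, z (n + i) = v i) := by
  have h1 : ∀ i ≤ n, (if i ≤ n then u i else v (i - n)) = u i := fun i hi => if_pos hi
  have h2 : ∀ i ≤ m, (if n + i ≤ n then u (n + i) else v (n + i - n)) = v i := by
    intro i hi
    rcases Nat.eq_zero_or_pos i with rfl | h
    · simpa using huv
    · rw [if_neg (by omega)]; congr 1; omega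
  refine ⟨fun i => if i ≤ n then u i else v (i - n), ?_, h1 0 (Nat.zero_le _), h2 m le_rfl, h1, h2⟩
  intro i hi j hj hij
  simp only [Set.mem_Iic] at hi hj
  have key : ∀ k, n ≤ k → k ≤ n + m →
      (if k ≤ n then u k else v (k - n)) = v (k - n) := by
    intro k hk hk'
    have := h2 (k - n) (by omega)
    rwa [Nat.add_sub_cancel' hk] at this
  beta_reduce
  rcases le_total j n with hjn | hjn
  · rw [h1 i (by omega), h1 j hjn]
    exact hu (by simp; omega) (by simpa using hjn) hij
  · rw [key j hjn hj]
    rcases le_total i n with hin | hin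
    · rw [h1 i hin]
      have a1 : u i ≤ u n := hu.monotoneOn (by simpa using hin) (by simp) hin
      have a2 : v 0 ≤ v (j - n) := hv.monotoneOn (by simp) (by simp; omega) (Nat.zero_le _)
      rcases hin.lt_or_eq with hlt | rfl
      · have : u i < u n := hu (by simpa using hin) (by simp) hlt
        linarith
      · have : v 0 < v (j - i) := hv (by simp) (by simp; omega) (by omega)
        linarith
    · rw [key i hin hi]
      exact hv (by simp; omega) (by simp; omega) (by omega)

lemma exists_chain_subset {a b : ℝ} (hab : a ≤ b) (P : Finset ℝ)
    (hP : (P : Set ℝ) ⊆ Set.Icc a b) :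
    ∃ (n : ℕ) (u : ℕ → ℝ), StrictMonoOn u (Set.Iic n) ∧ u 0 = a ∧ u n = b ∧
      (P : Set ℝ) ⊆ u '' Set.Iic n := by
  classical
  set Q : Finset ℝ := insert a (insert b P) with hQ
  have hne : Q.Nonempty := ⟨a, by simp [hQ]⟩
  have hQab : ∀ x ∈ Q, a ≤ x ∧ x ≤ b := by
    intro x hx
    simp only [hQ, Finset.mem_insert] at hx
    rcases hx with rfl | rfl | hx
    · exact ⟨le_rfl, hab⟩
    · exact ⟨hab, le_rfl⟩
    · exact hP hx
  obtain ⟨n, hn⟩ : ∃ n, Q.card = n + 1 := ⟨Q.card - 1, by have := hne.card_pos; omega⟩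
  set e := Q.orderEmbOfFin hn
  have hval : ∀ i : ℕ, ∀ hi : i < n + 1, (if h : i < n + 1 then e ⟨i, h⟩ else 0) = e ⟨i, hi⟩ :=
    fun i hi => dif_pos hi
  have hsurj : ∀ x ∈ Q, ∃ i : Fin (n + 1), e i = x := by
    intro x hx
    have : x ∈ Set.range e := by rw [Finset.range_orderEmbOfFin]; exact hx
    exact this
  refine ⟨n, fun i => if h : i < n + 1 then e ⟨i, h⟩ else 0, ?_, ?_, ?_, ?_⟩
  · intro i hi j hj hij
    simp only [Set.mem_Iic] at hi hj
    beta_reduce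
    rw [hval i (by omega), hval j (by omega)]
    exact e.strictMono hij
  · beta_reduce
    rw [hval 0 (by omega)]
    obtain ⟨i, hi⟩ := hsurj a (by simp [hQ])
    refine le_antisymm ?_ (hQab _ (Finset.orderEmbOfFin_mem Q hn _)).1
    rw [← hi]
    exact e.monotone (Fin.zero_le i)
  · beta_reduce
    rw [hval n (by omega)]
    obtain ⟨i, hi⟩ := hsurj b (by simp [hQ])
    refine le_antisymm (hQab _ (Finset.orderEmbOfFin_mem Q hn _)).2 ?_
    rw [← hi]
    exact e.monotone (Fin.le_last i)
  · intro x hx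
    obtain ⟨i, hi⟩ := hsurj x (by simp only [hQ, Finset.mem_insert]; exact Or.inr (Or.inr hx))
    refine ⟨i, by simp; omega, ?_⟩
    beta_reduce
    rw [hval i i.2]
    exact hi

/-! ### Sewing limits -/

lemma IsSewingLimit.sub {G : Type*} [NormedAddCommGroup G] {Ξ Ξ' : ℝ → ℝ → G} {a b : ℝ} {z z' : G}
    (h : IsSewingLimit Ξ a b z) (h' : IsSewingLimit Ξ' a b z') :
    IsSewingLimit (Ξ - Ξ') a b (z - z') := by
  classical
  intro ε hε
  obtain ⟨P, hP, h1⟩ := h (ε / 2) (by positivity)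
  obtain ⟨P', hP', h2⟩ := h' (ε / 2) (by positivity)
  refine ⟨P ∪ P', by simp [hP, hP'], fun n u hu ha hb hPu => ?_⟩
  rw [Finset.coe_union, Set.union_subset_iff] at hPu
  have e1 := h1 n u hu ha hb hPu.1
  have e2 := h2 n u hu ha hb hPu.2
  have : ∑ i ∈ Finset.range n, (Ξ - Ξ') (u i) (u (i + 1)) - (z - z')
      = (∑ i ∈ Finset.range n, Ξ (u i) (u (i + 1)) - z)
        - (∑ i ∈ Finset.range n, Ξ' (u i) (u (i + 1)) - z') := by
    simp only [Pi.sub_apply, Finset.sum_sub_distrib]; abel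
  rw [this]
  have := norm_sub_le (∑ i ∈ Finset.range n, Ξ (u i) (u (i + 1)) - z)
    (∑ i ∈ Finset.range n, Ξ' (u i) (u (i + 1)) - z')
  linarith

/-- The sewing limit is additive in the interval. -/
lemma IsSewingLimit.of_le {G : Type*} [NormedAddCommGroup G] {Ξ : ℝ → ℝ → G} {a s t : ℝ} {y z : G}
    (has : a ≤ s)
    (hs : IsSewingLimit Ξ a s y) (ht : IsSewingLimit Ξ a t z) :
    IsSewingLimit Ξ s t (z - y) := by
  classical
  intro ε hε
  obtain ⟨P, hP, h1⟩ := hs (ε / 2) (by positivity)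
  obtain ⟨Q, hQ, h2⟩ := ht (ε / 2) (by positivity)
  obtain ⟨m, v, hv, hva, hvs, hPv⟩ := exists_chain_subset has (P ∪ Q.filter (· ≤ s)) (by
    intro x hx
    simp only [Finset.coe_union, Finset.coe_filter, Set.mem_union, Set.mem_ofPred_eq] at hx
    rcases hx with hx | hx
    · exact hP hx
    · exact ⟨(hQ hx.1).1, hx.2⟩)
  refine ⟨Q.filter (s ≤ ·), ?_, fun n u hu hus hut hQu => ?_⟩
  · intro x hx
    simp only [Finset.coe_filter, Set.mem_ofPred_eq] at hx
    exact ⟨hx.2, (hQ hx.1).2⟩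
  obtain ⟨w, hw, hw0, hwn, hwv, hwu⟩ := exists_chain_append hv hu (hvs.trans hus.symm)
  have e1 := h1 m v hv hva hvs (fun x hx => hPv (by simp [Finset.mem_coe.1 hx]))
  have e2 := h2 (m + n) w hw (hw0.trans hva) (hwn.trans hut) (by
    intro x hx
    rcases le_total x s with hxs | hxs
    · obtain ⟨i, hi, rfl⟩ := hPv (a := x) (by simp [Finset.mem_coe.1 hx, hxs])
      simp only [Set.mem_Iic] at hi
      exact ⟨i, by simp; omega, hwv i hi⟩
    · obtain ⟨i, hi, rfl⟩ := hQu (a := x) (by simp [Finset.mem_coe.1 hx, hxs])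
      simp only [Set.mem_Iic] at hi
      exact ⟨m + i, by simp; omega, hwu i hi⟩)
  rw [Finset.sum_range_add] at e2
  have s1 : ∑ i ∈ Finset.range m, Ξ (w i) (w (i + 1))
      = ∑ i ∈ Finset.range m, Ξ (v i) (v (i + 1)) := by
    refine Finset.sum_congr rfl fun i hi => ?_
    rw [Finset.mem_range] at hi
    rw [hwv i (by omega), hwv (i + 1) (by omega)]
  have s2 : ∑ i ∈ Finset.range n, Ξ (w (m + i)) (w (m + i + 1))
      = ∑ i ∈ Finset.range n, Ξ (u i) (u (i + 1)) := by
    refine Finset.sum_congr rfl fun i hi => ?_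
    rw [Finset.mem_range] at hi
    rw [hwu i (by omega), add_assoc, hwu (i + 1) (by omega)]
  rw [s1, s2] at e2
  have : ∑ i ∈ Finset.range n, Ξ (u i) (u (i + 1)) - (z - y)
      = (∑ i ∈ Finset.range m, Ξ (v i) (v (i + 1)) + ∑ i ∈ Finset.range n, Ξ (u i) (u (i + 1)) - z)
        - (∑ i ∈ Finset.range m, Ξ (v i) (v (i + 1)) - y) := by abel
  rw [this]
  refine (norm_sub_le _ _).trans_lt ?_
  linarith

/-- A bound for all Riemann sums passes to the sewing limit. -/
lemma IsSewingLimit.norm_sub_le_of_forall {G : Type*} [NormedAddCommGroup G] {Ξ : ℝ → ℝ → G}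
    {a b : ℝ} {z c : G} {B : ℝ} (hab : a ≤ b) (h : IsSewingLimit Ξ a b z)
    (hB : ∀ (n : ℕ) (u : ℕ → ℝ), StrictMonoOn u (Set.Iic n) → u 0 = a → u n = b →
      ‖∑ i ∈ Finset.range n, Ξ (u i) (u (i + 1)) - c‖ ≤ B) :
    ‖z - c‖ ≤ B := by
  refine le_of_forall_pos_le_add fun ε hε => ?_
  obtain ⟨P, hP, h1⟩ := h ε hε
  obtain ⟨n, u, hu, ha, hb, hPu⟩ := exists_chain_subset hab P hP
  have e1 := h1 n u hu ha hb hPu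
  have e2 := hB n u hu ha hb
  have : z - c = (∑ i ∈ Finset.range n, Ξ (u i) (u (i + 1)) - c)
      - (∑ i ∈ Finset.range n, Ξ (u i) (u (i + 1)) - z) := by abel
  rw [this]
  refine (norm_sub_le _ _).trans ?_
  linarith

/-! ### Gauges and the sewing estimate -/

/-- A gauge of order `r` on `I`: a function `h` with values in `[0, 1]` such that `h ^ r` is
superadditive, that is, a control in the sense of rough path theory. A two-parameter function of
finite `r / m`-variation is bounded by a multiple of `h ^ m` for a suitable gauge `h`. -/
structure IsGauge (r : ℝ) (h : ℝ → ℝ → ℝ) (I : Set ℝ) : Prop where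
  nonneg : ∀ s t, 0 ≤ h s t
  le_one : ∀ s ∈ I, ∀ t ∈ I, s ≤ t → h s t ≤ 1
  superadd : ∀ s ∈ I, ∀ u ∈ I, ∀ t ∈ I, s ≤ u → u ≤ t → h s u ^ r + h u t ^ r ≤ h s t ^ r

namespace IsGauge

variable {r : ℝ} {h : ℝ → ℝ → ℝ} {I : Set ℝ}

lemma le_right (H : IsGauge r h I) (hr : 0 < r) {s u t : ℝ} (hs : s ∈ I) (hu : u ∈ I) (ht : t ∈ I)
    (hsu : s ≤ u) (hut : u ≤ t) : h s u ≤ h s t := by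
  have h1 := H.superadd s hs u hu t ht hsu hut
  have h2 := Real.rpow_nonneg (H.nonneg u t) r
  exact (Real.rpow_le_rpow_iff (H.nonneg _ _) (H.nonneg _ _) hr).1 (by linarith)

lemma le_left (H : IsGauge r h I) (hr : 0 < r) {s u t : ℝ} (hs : s ∈ I) (hu : u ∈ I) (ht : t ∈ I)
    (hsu : s ≤ u) (hut : u ≤ t) : h u t ≤ h s t := by
  have h1 := H.superadd s hs u hu t ht hsu hut
  have h2 := Real.rpow_nonneg (H.nonneg s u) r
  exact (Real.rpow_le_rpow_iff (H.nonneg _ _) (H.nonneg _ _) hr).1 (by linarith)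

lemma rpow_self (H : IsGauge r h I) {s : ℝ} (hs : s ∈ I) : h s s ^ r = 0 := by
  have h1 := H.superadd s hs s hs s hs le_rfl le_rfl
  have h2 := Real.rpow_nonneg (H.nonneg s s) r
  linarith

end IsGauge

/-- The constant of the sewing estimate `IsSewingLimit.norm_sub_le`. -/
noncomputable def sewingConst (r : ℝ) : ℝ := 2 / (1 - 2 * ((1 / 2 : ℝ) ^ (1 / r)) ^ 3)

lemma half_rpow_cube_lt {r : ℝ} (h0 : 0 < r) (h3 : r < 3) :
    2 * ((1 / 2 : ℝ) ^ (1 / r)) ^ 3 < 1 := by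
  have : ((1 / 2 : ℝ) ^ (1 / r)) ^ 3 < 1 / 2 := by
    rw [← Real.rpow_natCast, ← Real.rpow_mul (by norm_num)]
    conv_rhs => rw [← Real.rpow_one (1 / 2 : ℝ)]
    apply Real.rpow_lt_rpow_of_exponent_gt (by norm_num) (by norm_num)
    rw [one_div_mul_eq_div, lt_div_iff₀ h0]
    push_cast; linarith
  linarith

/-- Riemann sums of an almost additive germ. The chain from `u i` to `u j` is split at the last
point `u k` for which the control of `[u i, u k]` is at most half of the control of `[u i, u j]`; by
superadditivity the part after `u (k + 1)` has at most half of the control, too. So the cube of the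
gauge loses a factor `2 ^ (3 / r) > 2` on both parts, and the two errors add up to less than the
claimed bound, which leaves room for the two defects of additivity caused by the splitting. -/
lemma norm_chain_sum_sub_le {G : Type*} [NormedAddCommGroup G] {r : ℝ} (h0 : 0 < r) (h3 : r < 3)
    {h : ℝ → ℝ → ℝ} {I : Set ℝ} (H : IsGauge r h I) {Ξ : ℝ → ℝ → G} {D : ℝ} (hD : 0 ≤ D)
    (hdiag : ∀ s ∈ I, Ξ s s = 0)
    (hΞ : ∀ s ∈ I, ∀ u ∈ I, ∀ t ∈ I, s ≤ u → u ≤ t →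
      ‖Ξ s t - Ξ s u - Ξ u t‖ ≤ D * h s t ^ 3)
    {n : ℕ} {u : ℕ → ℝ} (hu : StrictMonoOn u (Set.Iic n)) (huI : ∀ i ≤ n, u i ∈ I) :
    ∀ d i j, i + d = j → j ≤ n →
      ‖∑ k ∈ Finset.Ico i j, Ξ (u k) (u (k + 1)) - Ξ (u i) (u j)‖
        ≤ sewingConst r * D * h (u i) (u j) ^ 3 := by
  have hlam := half_rpow_cube_lt h0 h3
  have hZpos : 0 < sewingConst r := by
    unfold sewingConst; apply div_pos (by norm_num); linarith
  have hmono : ∀ i j, i ≤ j → j ≤ n → u i ≤ u j := fun i j hij hj =>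
    hu.monotoneOn (by simp; omega) (by simpa using hj) hij
  have hlampow : ((1 / 2 : ℝ) ^ (1 / r)) ^ r = 1 / 2 := by
    rw [← Real.rpow_mul (by norm_num), one_div_mul_cancel h0.ne', Real.rpow_one]
  have hZ : sewingConst r * (1 - 2 * ((1 / 2 : ℝ) ^ (1 / r)) ^ 3) = 2 := by
    exact div_mul_cancel₀ _ (by linarith)
  have hl0 : 0 ≤ (1 / 2 : ℝ) ^ (1 / r) := by positivity
  revert hlampow hZ hl0
  generalize (1 / 2 : ℝ) ^ (1 / r) = lam
  intro hlampow hZ hl0 d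
  induction d using Nat.strong_induction_on with
  | _ d ih =>
  intro i j hij hj
  have hui := huI i (by omega)
  have huj := huI j hj
  rcases Nat.eq_zero_or_pos d with rfl | hd
  · obtain rfl : i = j := by omega
    simp only [Finset.Ico_self, Finset.sum_empty, hdiag _ hui, sub_zero, norm_zero]
    have := H.nonneg (u i) (u i)
    positivity
  classical
  -- the last index `k` in `[i, j)` at which the control is at most half of the total
  obtain ⟨k, hik, hkj, hk1, hk2⟩ : ∃ k, i ≤ k ∧ k < j ∧ h (u i) (u k) ^ r ≤ h (u i) (u j) ^ r / 2 ∧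
      h (u (k + 1)) (u j) ^ r ≤ h (u i) (u j) ^ r / 2 := by
    have hpos : 0 ≤ h (u i) (u j) ^ r / 2 := by
      have := Real.rpow_nonneg (H.nonneg (u i) (u j)) r
      linarith
    set S := (Finset.Ico i j).filter (fun k => h (u i) (u k) ^ r ≤ h (u i) (u j) ^ r / 2) with hS
    have hne : S.Nonempty := ⟨i, by
      simp only [hS, Finset.mem_filter, Finset.mem_Ico]
      exact ⟨⟨le_rfl, by omega⟩, by rw [H.rpow_self hui]; exact hpos⟩⟩
    have hmem := S.max'_mem hne
    have hmax : ∀ x ∈ S, x ≤ S.max' hne := fun x hx => S.le_max' x hx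
    revert hmem hmax
    generalize S.max' hne = k
    intro hmem hmax
    have hmem' := hmem
    simp only [hS, Finset.mem_filter, Finset.mem_Ico] at hmem'
    refine ⟨k, hmem'.1.1, hmem'.1.2, hmem'.2, ?_⟩
    rcases (show k + 1 ≤ j by omega).eq_or_lt with hkj | hkj
    · rw [hkj, H.rpow_self huj]; exact hpos
    · have : ¬ h (u i) (u (k + 1)) ^ r ≤ h (u i) (u j) ^ r / 2 := by
        intro hle
        have := hmax (k + 1) (by
          simp only [hS, Finset.mem_filter, Finset.mem_Ico]
          exact ⟨⟨by omega, hkj⟩, hle⟩)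
        omega
      have hsup := H.superadd (u i) hui (u (k + 1)) (huI _ (by omega)) (u j) huj
        (hmono _ _ (by omega) (by omega)) (hmono _ _ (by omega) (by omega))
      linarith
  have huk := huI k (by omega)
  have huk' := huI (k + 1) (by omega)
  have shrink : ∀ x, 0 ≤ x → x ^ r ≤ h (u i) (u j) ^ r / 2 → x ≤ lam * h (u i) (u j) := by
    intro x hx hle
    refine (Real.rpow_le_rpow_iff hx (mul_nonneg hl0 (H.nonneg _ _)) h0).1 ?_
    rw [Real.mul_rpow hl0 (H.nonneg _ _), hlampow]
    linarith
  have e1 := ih (k - i) (by omega) i k (by omega) (by omega)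
  have e2 := ih (j - (k + 1)) (by omega) (k + 1) j (by omega) hj
  have e3 := hΞ (u i) hui (u k) huk (u j) huj (hmono _ _ hik (by omega)) (hmono _ _ hkj.le hj)
  have e4 := hΞ (u k) huk (u (k + 1)) huk' (u j) huj (hmono _ _ (by omega) (by omega))
    (hmono _ _ (by omega) hj)
  have b1 := shrink _ (H.nonneg _ _) hk1
  have b2 := shrink _ (H.nonneg _ _) hk2
  have b3 : h (u k) (u j) ≤ h (u i) (u j) :=
    H.le_left h0 hui huk huj (hmono _ _ hik (by omega)) (hmono _ _ hkj.le hj)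
  have hsum : ∑ l ∈ Finset.Ico i j, Ξ (u l) (u (l + 1))
      = ∑ l ∈ Finset.Ico i k, Ξ (u l) (u (l + 1)) + Ξ (u k) (u (k + 1))
        + ∑ l ∈ Finset.Ico (k + 1) j, Ξ (u l) (u (l + 1)) := by
    rw [← Finset.sum_Ico_consecutive _ hik hkj.le, Finset.sum_eq_sum_Ico_succ_bot hkj, add_assoc]
  have hdec : ∑ l ∈ Finset.Ico i j, Ξ (u l) (u (l + 1)) - Ξ (u i) (u j)
      = (∑ l ∈ Finset.Ico i k, Ξ (u l) (u (l + 1)) - Ξ (u i) (u k))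
        + (∑ l ∈ Finset.Ico (k + 1) j, Ξ (u l) (u (l + 1)) - Ξ (u (k + 1)) (u j))
        - (Ξ (u i) (u j) - Ξ (u i) (u k) - Ξ (u k) (u j))
        - (Ξ (u k) (u j) - Ξ (u k) (u (k + 1)) - Ξ (u (k + 1)) (u j)) := by
    rw [hsum]; abel
  rw [hdec]
  have hh := H.nonneg (u i) (u j)
  have c1 : h (u i) (u k) ^ 3 ≤ (lam * h (u i) (u j)) ^ 3 := pow_le_pow_left₀ (H.nonneg _ _) b1 3
  have c2 : h (u (k + 1)) (u j) ^ 3 ≤ (lam * h (u i) (u j)) ^ 3 :=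
    pow_le_pow_left₀ (H.nonneg _ _) b2 3
  have c3 : h (u k) (u j) ^ 3 ≤ h (u i) (u j) ^ 3 := pow_le_pow_left₀ (H.nonneg _ _) b3 3
  have hZD : 0 ≤ sewingConst r * D := by positivity
  refine (norm_sub_le _ _).trans ((add_le_add_left ((norm_sub_le _ _).trans
    (add_le_add_left (norm_add_le _ _) _)) _).trans ?_)
  calc _ ≤ sewingConst r * D * (lam * h (u i) (u j)) ^ 3
        + sewingConst r * D * (lam * h (u i) (u j)) ^ 3
        + D * h (u i) (u j) ^ 3 + D * h (u i) (u j) ^ 3 := by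
        gcongr
        · exact e1.trans (by gcongr)
        · exact e2.trans (by gcongr)
        · exact e4.trans (by gcongr)
    _ = sewingConst r * D * h (u i) (u j) ^ 3
        - (sewingConst r * (1 - 2 * lam ^ 3) - 2) * D * h (u i) (u j) ^ 3 := by ring
    _ = _ := by rw [hZ]; ring

lemma sewingConst_pos {r : ℝ} (h0 : 0 < r) (h3 : r < 3) : 0 < sewingConst r := by
  have := half_rpow_cube_lt h0 h3
  exact div_pos (by norm_num) (by linarith)

/-- The sewing estimate: the limit of the Riemann sums of a germ whose defect of additivity is at
most `D * h ^ 3` differs from the germ by at most a constant times `D * h ^ 3`. -/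
lemma IsSewingLimit.norm_sub_le {G : Type*} [NormedAddCommGroup G] {r : ℝ} (h0 : 0 < r) (h3 : r < 3)
    {h : ℝ → ℝ → ℝ} {I : Set ℝ} (hI : I.OrdConnected) (H : IsGauge r h I) {Ξ : ℝ → ℝ → G}
    {D : ℝ} (hD : 0 ≤ D) (hdiag : ∀ s ∈ I, Ξ s s = 0)
    (hΞ : ∀ s ∈ I, ∀ u ∈ I, ∀ t ∈ I, s ≤ u → u ≤ t →
      ‖Ξ s t - Ξ s u - Ξ u t‖ ≤ D * h s t ^ 3)
    {s t : ℝ} (hs : s ∈ I) (ht : t ∈ I) (hst : s ≤ t) {z : G} (hz : IsSewingLimit Ξ s t z) :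
    ‖z - Ξ s t‖ ≤ sewingConst r * D * h s t ^ 3 := by
  refine hz.norm_sub_le_of_forall hst fun n u hu h_s h_t => ?_
  have huI : ∀ i ≤ n, u i ∈ I := by
    intro i hi
    refine hI.out hs ht ⟨?_, ?_⟩
    · rw [← h_s]; exact hu.monotoneOn (by simp) (by simpa using hi) (Nat.zero_le i)
    · rw [← h_t]; exact hu.monotoneOn (by simpa using hi) (by simp) hi
  have := norm_chain_sum_sub_le h0 h3 H hD hdiag hΞ hu huI n 0 n (by omega) le_rfl
  rwa [h_s, h_t, ← Finset.range_eq_Ico] at this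

/-! ### From finite variation to gauges and back -/

/-- The finite increasing sequences in `I` from `s` to `t`, as pairs of a length and a sequence of
which only the first `n + 1` terms matter. -/
def chains (I : Set ℝ) (s t : ℝ) : Set (ℕ × (ℕ → ℝ)) :=
  {c | StrictMonoOn c.2 (Set.Iic c.1) ∧ (∀ i ≤ c.1, c.2 i ∈ I) ∧ c.2 0 = s ∧ c.2 c.1 = t}

/-- The control associated with a two-parameter function: the supremum of `∑ χ(u_i, u_{i+1}) ^ p`
over the increasing sequences in `I` that start at `s` and end at `t`. Fixing the end points makes
superadditivity a matter of concatenation. -/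
noncomputable def chainControl (p : ℝ) (χ : ℝ → ℝ → ℝ≥0∞) (I : Set ℝ) (s t : ℝ) : ℝ≥0∞ :=
  ⨆ c ∈ chains I s t, ∑ i ∈ Finset.range c.1, χ (c.2 i) (c.2 (i + 1)) ^ p

lemma pair_mem_chains {I : Set ℝ} {s t : ℝ} (hs : s ∈ I) (ht : t ∈ I) (hst : s < t) :
    (1, fun i : ℕ => if i = 0 then s else t) ∈ chains I s t := by
  refine ⟨?_, ?_, by simp, by simp⟩
  · intro i hi j hj hij
    simp only [Set.mem_Iic] at hi hj
    obtain rfl : i = 0 := by omega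
    obtain rfl : j = 1 := by omega
    simpa using hst
  · intro i _
    dsimp only
    split_ifs <;> assumption

lemma chains_nonempty {I : Set ℝ} {s t : ℝ} (hs : s ∈ I) (ht : t ∈ I) (hst : s ≤ t) :
    (chains I s t).Nonempty := by
  rcases hst.eq_or_lt with rfl | hst
  · refine ⟨(0, fun _ => s), ?_, fun _ _ => hs, rfl, rfl⟩
    intro i hi j hj hij
    simp only [Set.mem_Iic] at hi hj
    omega
  · exact ⟨_, pair_mem_chains hs ht hst⟩

lemma rpow_le_chainControl (p : ℝ) (χ : ℝ → ℝ → ℝ≥0∞) {I : Set ℝ} {s t : ℝ} (hs : s ∈ I)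
    (ht : t ∈ I) (hst : s < t) : χ s t ^ p ≤ chainControl p χ I s t := by
  refine le_trans ?_ (le_iSup₂ (f := fun (c : ℕ × (ℕ → ℝ)) (_ : c ∈ chains I s t) =>
    ∑ i ∈ Finset.range c.1, χ (c.2 i) (c.2 (i + 1)) ^ p) _ (pair_mem_chains hs ht hst))
  simp

lemma chainControl_le {p : ℝ} (hp : 0 < p) (χ : ℝ → ℝ → ℝ≥0∞) (I : Set ℝ) (s t : ℝ) :
    chainControl p χ I s t ≤ variation p χ I ^ p := by
  refine iSup₂_le fun c hc => ?_
  have : (∑ i ∈ Finset.range c.1, χ (c.2 i) (c.2 (i + 1)) ^ p) ^ (1 / p) ≤ variation p χ I := by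
    unfold variation
    exact le_iSup_of_le c.1 (le_iSup_of_le c.2 (le_iSup₂_of_le hc.1 hc.2.1 le_rfl))
  have := ENNReal.rpow_le_rpow this hp.le
  rwa [← ENNReal.rpow_mul, one_div_mul_cancel hp.ne', ENNReal.rpow_one] at this

lemma chainControl_superadd (p : ℝ) (χ : ℝ → ℝ → ℝ≥0∞) {I : Set ℝ} {s u t : ℝ} (hs : s ∈ I)
    (hu : u ∈ I) (ht : t ∈ I) (hsu : s ≤ u) (hut : u ≤ t) :
    chainControl p χ I s u + chainControl p χ I u t ≤ chainControl p χ I s t := by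
  refine ENNReal.biSup_add_biSup_le (chains_nonempty hs hu hsu) (chains_nonempty hu ht hut) ?_
  rintro ⟨n, v⟩ ⟨hv, hvI, hv0, hvn⟩ ⟨m, w⟩ ⟨hw, hwI, hw0, hwm⟩
  dsimp only at *
  obtain ⟨z, hz, hz0, hzn, hzv, hzw⟩ := exists_chain_append hv hw (hvn.trans hw0.symm)
  refine le_trans (le_of_eq ?_) (le_iSup₂ (f := fun (c : ℕ × (ℕ → ℝ)) (_ : c ∈ chains I s t) =>
    ∑ i ∈ Finset.range c.1, χ (c.2 i) (c.2 (i + 1)) ^ p) (n + m, z) ⟨hz, ?_, ?_, ?_⟩)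
  · dsimp only
    rw [Finset.sum_range_add]
    congr 1
    · refine Finset.sum_congr rfl fun i hi => ?_
      rw [Finset.mem_range] at hi
      rw [hzv i (by omega), hzv (i + 1) (by omega)]
    · refine Finset.sum_congr rfl fun i hi => ?_
      rw [Finset.mem_range] at hi
      rw [hzw i (by omega), add_assoc, hzw (i + 1) (by omega)]
  · intro i hi
    dsimp only at hi ⊢
    rcases le_total i n with hin | hin
    · rw [hzv i hin]; exact hvI i hin
    · obtain ⟨k, rfl⟩ := Nat.exists_eq_add_of_le hin
      rw [hzw k (by omega)]; exact hwI k (by omega)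
  · exact hz0.trans hv0
  · exact hzn.trans hwm

/-- A function of finite `p`-variation is bounded by the `p`-th root of a normalised control. -/
lemma exists_control {p : ℝ} (hp : 0 < p) (q : ℝ → ℝ → ℝ) (I : Set ℝ)
    (hfin : variation p (fun s t => ENNReal.ofReal (q s t)) I < ∞) :
    ∃ ω : ℝ → ℝ → ℝ, (∀ s t, 0 ≤ ω s t) ∧ (∀ s t, ω s t ≤ 1) ∧
      (∀ s ∈ I, ∀ u ∈ I, ∀ t ∈ I, s ≤ u → u ≤ t → ω s u + ω u t ≤ ω s t) ∧
      ∀ s ∈ I, ∀ t ∈ I, s < t → q s t ≤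
        (variation p (fun s t => ENNReal.ofReal (q s t)) I).toReal * ω s t ^ (1 / p) := by
  have hle := fun s t => chainControl_le hp (fun s t => ENNReal.ofReal (q s t)) I s t
  have hq := fun s (hs : s ∈ I) t (ht : t ∈ I) =>
    rpow_le_chainControl p (fun s t => ENNReal.ofReal (q s t)) hs ht
  have hadd := fun s (hs : s ∈ I) u (hu : u ∈ I) t (ht : t ∈ I) =>
    chainControl_superadd p (fun s t => ENNReal.ofReal (q s t)) hs hu ht
  revert hle hq hadd hfin
  generalize chainControl p (fun s t => ENNReal.ofReal (q s t)) I = W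
  generalize variation p (fun s t => ENNReal.ofReal (q s t)) I = V
  intro hfin hle hq hadd
  have hVp : V ^ p ≠ ∞ := ENNReal.rpow_ne_top_of_nonneg hp.le hfin.ne
  have hone : ∀ s t, W s t / V ^ p ≤ 1 := fun s t =>
    ENNReal.div_le_of_le_mul (by simpa using hle s t)
  have hne : ∀ s t, W s t / V ^ p ≠ ∞ := fun s t => ((hone s t).trans_lt ENNReal.one_lt_top).ne
  refine ⟨fun s t => (W s t / V ^ p).toReal, fun s t => ENNReal.toReal_nonneg, fun s t => ?_,
    fun s hs u hu t ht hsu hut => ?_, fun s hs t ht hst => ?_⟩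
  · exact ENNReal.toReal_le_of_le_ofReal zero_le_one (by simpa using hone s t)
  · beta_reduce
    rw [← ENNReal.toReal_add (hne _ _) (hne _ _), ENNReal.div_add_div_same]
    exact ENNReal.toReal_mono (hne _ _) (ENNReal.div_le_div_right (hadd s hs u hu t ht hsu hut) _)
  · have h1 := hq s hs t ht hst
    have h2 : ENNReal.ofReal (q s t) ≤ V * (W s t / V ^ p) ^ (1 / p) := by
      rw [← ENNReal.rpow_le_rpow_iff hp, ENNReal.mul_rpow_of_nonneg _ _ hp.le,
        ← ENNReal.rpow_mul, one_div_mul_cancel hp.ne', ENNReal.rpow_one]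
      rcases eq_or_ne (V ^ p) 0 with h0 | h0
      · have := hle s t
        rw [h0] at this
        exact (h1.trans this).trans zero_le
      · rwa [ENNReal.mul_div_cancel h0 hVp]
    have h3 : V * (W s t / V ^ p) ^ (1 / p) ≠ ∞ :=
      ENNReal.mul_ne_top hfin.ne (ENNReal.rpow_ne_top_of_nonneg (by positivity) (hne s t))
    have h4 := (ENNReal.ofReal_le_iff_le_toReal h3).1 h2
    rwa [ENNReal.toReal_mul, ← ENNReal.toReal_rpow] at h4

/-- The `r / m`-variation of a non-negative real function, as a real number (zero if infinite). -/
noncomputable def realVariation (r : ℝ) (m : ℕ) (q : ℝ → ℝ → ℝ) (I : Set ℝ) : ℝ :=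
  (variation (r / m) (fun s t => ENNReal.ofReal (q s t)) I).toReal

/-- `q` has finite `r / m`-variation over `I`. -/
def FiniteVariation (r : ℝ) (m : ℕ) (q : ℝ → ℝ → ℝ) (I : Set ℝ) : Prop :=
  variation (r / m) (fun s t => ENNReal.ofReal (q s t)) I < ∞

/-- `q ≤ c * h ^ m` on the increasing pairs in `I`. -/
def GaugeBound (h : ℝ → ℝ → ℝ) (I : Set ℝ) (q : ℝ → ℝ → ℝ) (c : ℝ) (m : ℕ) : Prop :=
  ∀ s ∈ I, ∀ t ∈ I, s ≤ t → q s t ≤ c * h s t ^ m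

/-- Finitely many functions of finite `r / m`-variation are bounded by powers of one common gauge,
in which each function enters with its own variation as a factor. -/
lemma exists_gauge {ι : Type*} [Fintype ι] [Nonempty ι] {r : ℝ} (hr : 0 < r) (m : ι → ℕ)
    (hm : ∀ k, 0 < m k) (hmr : ∀ k, (m k : ℝ) ≤ r) (q : ι → ℝ → ℝ → ℝ) (I : Set ℝ)
    (hq : ∀ k, ∀ s ∈ I, q k s s = 0)
    (hfin : ∀ k, FiniteVariation r (m k) (q k) I) :
    ∃ h, IsGauge r h I ∧ ∀ k,
      GaugeBound h I (q k) (Fintype.card ι * realVariation r (m k) (q k) I) (m k) := by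
  have hm' : ∀ k, 0 < (m k : ℝ) := fun k => by exact_mod_cast hm k
  choose ω h0 h1 hadd hle using fun k => exists_control (div_pos hr (hm' k)) (q k) I (hfin k)
  have hK : (1 : ℝ) ≤ Fintype.card ι := by exact_mod_cast Fintype.card_pos
  set K : ℝ := (Fintype.card ι : ℝ) with hKdef
  have hsum0 : ∀ s t, 0 ≤ K⁻¹ * ∑ k, ω k s t := fun s t =>
    mul_nonneg (by positivity) (Finset.sum_nonneg fun k _ => h0 k s t)
  have hpow : ∀ s t, ((K⁻¹ * ∑ k, ω k s t) ^ (1 / r)) ^ r = K⁻¹ * ∑ k, ω k s t := fun s t => by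
    rw [← Real.rpow_mul (hsum0 s t), one_div_mul_cancel hr.ne', Real.rpow_one]
  refine ⟨fun s t => (K⁻¹ * ∑ k, ω k s t) ^ (1 / r), ⟨fun s t => Real.rpow_nonneg (hsum0 s t) _,
    fun s _ t _ _ => ?_, fun s hs u hu t ht hsu hut => ?_⟩, fun k s hs t ht hst => ?_⟩
  · refine Real.rpow_le_one (hsum0 s t) ?_ (by positivity)
    have : ∑ k, ω k s t ≤ ∑ _k : ι, (1 : ℝ) := Finset.sum_le_sum fun k _ => h1 k s t
    rw [Finset.sum_const, Finset.card_univ, nsmul_eq_mul, mul_one, ← hKdef] at this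
    calc K⁻¹ * ∑ k, ω k s t ≤ K⁻¹ * K := by gcongr
      _ = 1 := inv_mul_cancel₀ (by positivity)
  · rw [hpow, hpow, hpow, ← mul_add, ← Finset.sum_add_distrib]
    gcongr with k
    exact hadd k s hs u hu t ht hsu hut
  · unfold realVariation
    rcases hst.eq_or_lt with rfl | hst
    · rw [hq k s hs]
      have := Real.rpow_nonneg (hsum0 s s) (1 / r)
      positivity
    · refine (hle k s hs t ht hst).trans ?_
      rw [mul_comm K, mul_assoc]
      gcongr
      have e1 : ω k s t ≤ K * (K⁻¹ * ∑ k, ω k s t) := by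
        rw [mul_inv_cancel_left₀ (by positivity)]
        exact Finset.single_le_sum (f := fun k => ω k s t) (fun k _ => h0 k s t)
          (Finset.mem_univ k)
      rw [one_div_div, ← Real.rpow_natCast, ← Real.rpow_mul (hsum0 s t), one_div_mul_eq_div]
      calc ω k s t ^ ((m k : ℝ) / r) ≤ (K * (K⁻¹ * ∑ k, ω k s t)) ^ ((m k : ℝ) / r) := by
            apply Real.rpow_le_rpow (h0 k s t) e1; have := hm' k; positivity
        _ = K ^ ((m k : ℝ) / r) * (K⁻¹ * ∑ k, ω k s t) ^ ((m k : ℝ) / r) :=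
            Real.mul_rpow (by positivity) (hsum0 s t)
        _ ≤ K * (K⁻¹ * ∑ k, ω k s t) ^ ((m k : ℝ) / r) := by
            gcongr
            · exact Real.rpow_nonneg (hsum0 s t) _
            · conv_rhs => rw [← Real.rpow_one K]
              exact Real.rpow_le_rpow_of_exponent_le hK ((div_le_one hr).2 (hmr k))

lemma IsGauge.sum_rpow_le {r : ℝ} {h : ℝ → ℝ → ℝ} {I : Set ℝ} (H : IsGauge r h I) {n : ℕ}
    {u : ℕ → ℝ} (hu : StrictMonoOn u (Set.Iic n)) (huI : ∀ i ≤ n, u i ∈ I) :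
    ∀ k ≤ n, ∑ i ∈ Finset.range k, h (u i) (u (i + 1)) ^ r ≤ h (u 0) (u k) ^ r := by
  intro k
  induction k with
  | zero => intro _; simpa using Real.rpow_nonneg (H.nonneg _ _) r
  | succ k ih =>
    intro hk
    rw [Finset.sum_range_succ]
    have := ih (by omega)
    have := H.superadd (u 0) (huI 0 (by omega)) (u k) (huI k (by omega)) (u (k + 1)) (huI _ hk)
      (hu.monotoneOn (by simp) (by simp; omega) (Nat.zero_le _))
      (hu.monotoneOn (by simp; omega) (by simpa using hk) (by omega))
    linarith

/-- A pointwise bound by `C * h ^ m` for a gauge `h` bounds the `r / m`-variation by `C`. -/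
lemma IsGauge.variation_le {r : ℝ} (hr : 0 < r) {h : ℝ → ℝ → ℝ} {I : Set ℝ} (H : IsGauge r h I)
    {m : ℕ} (hm : 0 < m) {C : ℝ} (hC : 0 ≤ C) {χ : ℝ → ℝ → ℝ≥0∞}
    (hχ : ∀ s ∈ I, ∀ t ∈ I, s ≤ t → χ s t ≤ ENNReal.ofReal (C * h s t ^ m)) :
    variation (r / m) χ I ≤ ENNReal.ofReal C := by
  have hm' : 0 < (m : ℝ) := by exact_mod_cast hm
  have hp : 0 < r / m := div_pos hr hm'
  refine iSup_le fun n => iSup_le fun u => iSup₂_le fun hu huI => ?_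
  rw [one_div, ENNReal.rpow_inv_le_iff hp, ENNReal.ofReal_rpow_of_nonneg hC hp.le]
  calc ∑ i ∈ Finset.range n, χ (u i) (u (i + 1)) ^ (r / m)
      ≤ ∑ i ∈ Finset.range n, ENNReal.ofReal (C ^ (r / m) * h (u i) (u (i + 1)) ^ r) := by
        refine Finset.sum_le_sum fun i hi => ?_
        rw [Finset.mem_range] at hi
        have hh := H.nonneg (u i) (u (i + 1))
        refine (ENNReal.rpow_le_rpow (hχ _ (huI i (by omega)) _ (huI (i + 1) (by omega))
          (hu.monotoneOn (by simp; omega) (by simp; omega) (by omega))) hp.le).trans ?_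
        rw [ENNReal.ofReal_rpow_of_nonneg (by positivity) hp.le,
          Real.mul_rpow hC (by positivity), ← Real.rpow_natCast, ← Real.rpow_mul hh,
          mul_div_cancel₀ r hm'.ne']
    _ = ENNReal.ofReal (C ^ (r / m) * ∑ i ∈ Finset.range n, h (u i) (u (i + 1)) ^ r) := by
        rw [Finset.mul_sum, ENNReal.ofReal_sum_of_nonneg]
        intro i _
        have := Real.rpow_nonneg (H.nonneg (u i) (u (i + 1))) r
        positivity
    _ ≤ ENNReal.ofReal (C ^ (r / m)) := by
        apply ENNReal.ofReal_le_ofReal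
        refine mul_le_of_le_one_right (by positivity) ((H.sum_rpow_le hu huI n le_rfl).trans ?_)
        exact Real.rpow_le_one (H.nonneg _ _) (H.le_one _ (huI 0 (by omega)) _ (huI n le_rfl)
          (hu.monotoneOn (by simp) (by simp) (Nat.zero_le _))) hr.le

lemma IsGauge.variation_le_of_gaugeBound {r : ℝ} (hr : 0 < r) {h : ℝ → ℝ → ℝ} {I : Set ℝ}
    (H : IsGauge r h I) {m : ℕ} (hm : 0 < m) {C : ℝ} (hC : 0 ≤ C) {q : ℝ → ℝ → ℝ}
    (hq : GaugeBound h I q C m) :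
    variation (r / m) (fun s t => ENNReal.ofReal (q s t)) I ≤ ENNReal.ofReal C :=
  H.variation_le hr hm hC fun s hs t ht hst => ENNReal.ofReal_le_ofReal (hq s hs t ht hst)

lemma IsGauge.realVariation_le {r : ℝ} (hr : 0 < r) {h : ℝ → ℝ → ℝ} {I : Set ℝ}
    (H : IsGauge r h I) {m : ℕ} (hm : 0 < m) {C : ℝ} (hC : 0 ≤ C) {q : ℝ → ℝ → ℝ}
    (hq : GaugeBound h I q C m) : realVariation r m q I ≤ C :=
  ENNReal.toReal_le_of_le_ofReal hC (H.variation_le_of_gaugeBound hr hm hC hq)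

lemma realVariation_nonneg (r : ℝ) (m : ℕ) (q : ℝ → ℝ → ℝ) (I : Set ℝ) :
    0 ≤ realVariation r m q I := ENNReal.toReal_nonneg

lemma FiniteVariation.of_le_add {r : ℝ} {m : ℕ} (hm : 0 < m) (hmr : (m : ℝ) ≤ r)
    {q q₁ q₂ : ℝ → ℝ → ℝ} {I : Set ℝ} (h₁ : FiniteVariation r m q₁ I)
    (h₂ : FiniteVariation r m q₂ I) (hq₁ : ∀ s ∈ I, q₁ s s = 0) (hq₂ : ∀ s ∈ I, q₂ s s = 0)
    (hq : ∀ s t, q s t ≤ q₁ s t + q₂ s t) : FiniteVariation r m q I := by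
  have hr : 0 < r := lt_of_lt_of_le (by exact_mod_cast hm) hmr
  obtain ⟨h, H, hle⟩ := exists_gauge (ι := Bool) hr (fun _ => m) (fun _ => hm) (fun _ => hmr)
    (fun b => if b then q₁ else q₂) I (by simpa using ⟨hq₂, hq₁⟩) (by simpa using ⟨h₂, h₁⟩)
  have n1 := realVariation_nonneg r m q₁ I
  have n2 := realVariation_nonneg r m q₂ I
  refine (H.variation_le_of_gaugeBound hr hm
    (C := 2 * realVariation r m q₁ I + 2 * realVariation r m q₂ I) (by positivity)
    fun s hs t ht hst => ?_).trans_lt ENNReal.ofReal_lt_top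
  have e1 := hle true s hs t ht hst
  have e2 := hle false s hs t ht hst
  simp only [if_true, Bool.false_eq_true, if_false, Fintype.card_bool, Nat.cast_ofNat] at e1 e2
  have := hq s t
  linarith

lemma variation_mono (p : ℝ) (χ : ℝ → ℝ → ℝ≥0∞) {I J : Set ℝ} (hIJ : I ⊆ J) :
    variation p χ I ≤ variation p χ J :=
  iSup_mono fun _ => iSup_mono fun _ => iSup_mono fun _ =>
    iSup_mono' fun h => ⟨fun i hi => hIJ (h i hi), le_rfl⟩

lemma FiniteVariation.mono {r : ℝ} {m : ℕ} {q : ℝ → ℝ → ℝ} {I J : Set ℝ} (hIJ : I ⊆ J)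
    (h : FiniteVariation r m q J) : FiniteVariation r m q I := (variation_mono _ _ hIJ).trans_lt h

lemma FiniteVariation.realVariation_mono {r : ℝ} {m : ℕ} {q : ℝ → ℝ → ℝ} {I J : Set ℝ}
    (h : FiniteVariation r m q J) (hIJ : I ⊆ J) : realVariation r m q I ≤ realVariation r m q J :=
  ENNReal.toReal_mono h.ne (variation_mono _ _ hIJ)

/-! ### Differences of increments of smooth functions -/

/-- Increments `g (y + a) - g y` depend on `y` and `a` in a Lipschitz way, with a factor `‖b‖` in
the dependence on `y`. -/
def FourPointLipschitz {F G : Type*} [NormedAddCommGroup F] [NormedAddCommGroup G] (g : F → G)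
    (A : ℝ) : Prop :=
  ∀ y z a b, ‖g (y + a) - g y - (g (z + b) - g z)‖ ≤ A * (‖a - b‖ + ‖y - z‖ * ‖b‖)

section

variable {F G : Type*} [NormedAddCommGroup F] [NormedAddCommGroup G]

lemma FourPointLipschitz.norm_sub_le {g : F → G} {A : ℝ} (h : FourPointLipschitz g A) (y z : F) :
    ‖g y - g z‖ ≤ A * ‖y - z‖ := by
  have := h z z (y - z) 0
  simpa using this

lemma FourPointLipschitz.mono {g : F → G} {A B : ℝ} (h : FourPointLipschitz g A) (hAB : A ≤ B) :
    FourPointLipschitz g B := fun y z a b => (h y z a b).trans (by gcongr)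

variable [NormedSpace ℝ G]

lemma FourPointLipschitz.comp {H K : Type*} [NormedAddCommGroup H] [NormedSpace ℝ H]
    [NormedAddCommGroup K] [NormedSpace ℝ K] {P : F → G →L[ℝ] H} {Q : F → K →L[ℝ] G} {A : ℝ}
    (hP : FourPointLipschitz P A) (hQ : FourPointLipschitz Q A) (hPb : ∀ y, ‖P y‖ ≤ A)
    (hQb : ∀ y, ‖Q y‖ ≤ A) : FourPointLipschitz (fun y => (P y).comp (Q y)) (4 * A ^ 2) := by
  intro y z a b
  have hA : 0 ≤ A := (norm_nonneg _).trans (hPb 0)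
  have e : (P (y + a)).comp (Q (y + a)) - (P y).comp (Q y)
      - ((P (z + b)).comp (Q (z + b)) - (P z).comp (Q z))
      = (P (y + a) - P y - (P (z + b) - P z)).comp (Q (y + a))
        + (P (z + b) - P z).comp ((Q (y + a) - Q (y + b)) + (Q (y + b) - Q (z + b)))
        + (P y).comp (Q (y + a) - Q y - (Q (z + b) - Q z))
        + (P y - P z).comp (Q (z + b) - Q z) := by
    ext v
    simp only [ContinuousLinearMap.comp_apply, sub_apply, add_apply,
      map_sub, map_add]
    abel
  dsimp only
  rw [e]
  have p1 := hP y z a b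
  have p2 := hP.norm_sub_le (z + b) z
  have p2' : ‖P (z + b) - P z‖ ≤ 2 * A :=
    (_root_.norm_sub_le _ _).trans (by have := hPb (z + b); have := hPb z; linarith)
  have p3 := hP.norm_sub_le y z
  have q1 := hQ y z a b
  have q2 := hQ.norm_sub_le (z + b) z
  have q3 := hQ.norm_sub_le (y + a) (y + b)
  have q4 := hQ.norm_sub_le (y + b) (z + b)
  simp only [add_sub_cancel_left, add_sub_add_left_eq_sub, add_sub_add_right_eq_sub] at p2 q2 q3 q4
  have t1 : ‖(P (y + a) - P y - (P (z + b) - P z)).comp (Q (y + a))‖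
      ≤ A * (‖a - b‖ + ‖y - z‖ * ‖b‖) * A :=
    (ContinuousLinearMap.opNorm_comp_le _ _).trans (by gcongr; exact hQb _)
  have t2 : ‖(P (z + b) - P z).comp ((Q (y + a) - Q (y + b)) + (Q (y + b) - Q (z + b)))‖
      ≤ 2 * A * (A * ‖a - b‖) + A * ‖b‖ * (A * ‖y - z‖) := by
    refine (ContinuousLinearMap.opNorm_comp_le _ _).trans ?_
    calc _ ≤ ‖P (z + b) - P z‖ * (‖Q (y + a) - Q (y + b)‖ + ‖Q (y + b) - Q (z + b)‖) := by
          gcongr; exact norm_add_le _ _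
      _ = ‖P (z + b) - P z‖ * ‖Q (y + a) - Q (y + b)‖
          + ‖P (z + b) - P z‖ * ‖Q (y + b) - Q (z + b)‖ := by ring
      _ ≤ _ := by gcongr
  have t3 : ‖(P y).comp (Q (y + a) - Q y - (Q (z + b) - Q z))‖
      ≤ A * (A * (‖a - b‖ + ‖y - z‖ * ‖b‖)) :=
    (ContinuousLinearMap.opNorm_comp_le _ _).trans (by gcongr; exact hPb _)
  have t4 : ‖(P y - P z).comp (Q (z + b) - Q z)‖ ≤ A * ‖y - z‖ * (A * ‖b‖) :=
    (ContinuousLinearMap.opNorm_comp_le _ _).trans (by gcongr)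
  refine (norm_add_le _ _).trans ((add_le_add_left ((norm_add_le _ _).trans
    (add_le_add_left (norm_add_le _ _) _)) _).trans ?_)
  calc _ ≤ A * (‖a - b‖ + ‖y - z‖ * ‖b‖) * A
        + (2 * A * (A * ‖a - b‖) + A * ‖b‖ * (A * ‖y - z‖))
        + A * (A * (‖a - b‖ + ‖y - z‖ * ‖b‖)) + A * ‖y - z‖ * (A * ‖b‖) := by gcongr
    _ = _ := by ring

variable [NormedSpace ℝ F]

lemma fourPointLipschitz_of_fderiv {g : F → G} {A : ℝ} (hg : Differentiable ℝ g)
    (hb : ∀ y, ‖fderiv ℝ g y‖ ≤ A) (hl : ∀ y z, ‖fderiv ℝ g y - fderiv ℝ g z‖ ≤ A * ‖y - z‖) :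
    FourPointLipschitz g A := by
  intro y z a b
  have h1 : ‖g (y + a) - g (y + b)‖ ≤ A * ‖a - b‖ := by
    have := Convex.norm_image_sub_le_of_norm_fderiv_le (𝕜 := ℝ) (f := g) (s := Set.univ) (C := A)
      (fun x _ => hg x) (fun x _ => hb x) convex_univ (Set.mem_univ (y + b)) (Set.mem_univ (y + a))
    simpa using this
  have h2 : ‖(g (y + b) - g y) - (g (z + b) - g z)‖ ≤ A * ‖b‖ * ‖y - z‖ := by
    refine Convex.norm_image_sub_le_of_norm_hasFDerivWithin_le (𝕜 := ℝ) (s := Set.univ)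
      (f := fun x => g (x + b) - g x) (f' := fun x => fderiv ℝ g (x + b) - fderiv ℝ g x)
      (fun x _ => ?_) (fun x _ => ?_) convex_univ (Set.mem_univ z) (Set.mem_univ y)
    · have e1 : HasFDerivAt (fun x => g (x + b)) (fderiv ℝ g (x + b)) x :=
        (hasFDerivAt_comp_add_right b).2 (hg (x + b)).hasFDerivAt
      exact (e1.sub (hg x).hasFDerivAt).hasFDerivWithinAt
    · simpa using hl (x + b) x
  have : g (y + a) - g y - (g (z + b) - g z)
      = (g (y + a) - g (y + b)) + ((g (y + b) - g y) - (g (z + b) - g z)) := by abel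
  rw [this]
  refine (norm_add_le _ _).trans ((add_le_add h1 h2).trans (le_of_eq ?_))
  ring

/-- First order Taylor remainders depend on the base point and on the increment in a Lipschitz way.
Both parts follow from the mean value inequality in the increment alone: the remainder at `y` minus
the one at `z` vanishes for the increment `0`, and its derivative in the increment is a difference
of increments of `fderiv ℝ g`. -/
lemma norm_taylor_sub_le {g : F → G} {A : ℝ} (hA : 0 ≤ A) (hg : Differentiable ℝ g)
    (hl : FourPointLipschitz (fderiv ℝ g) A) (y z a b : F) :
    ‖(g (y + a) - g y - fderiv ℝ g y a) - (g (z + b) - g z - fderiv ℝ g z b)‖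
      ≤ A * ((‖a‖ + ‖b‖) * ‖a - b‖ + ‖y - z‖ * ‖b‖ ^ 2) := by
  have hd : ∀ x c, HasFDerivAt (fun c => g (x + c) - g x - fderiv ℝ g x c)
      (fderiv ℝ g (x + c) - fderiv ℝ g x) c := by
    intro x c
    have e1 : HasFDerivAt (fun c => g (x + c)) (fderiv ℝ g (x + c)) c :=
      (hasFDerivAt_comp_add_left x).2 (hg (x + c)).hasFDerivAt
    exact (e1.sub_const _).sub (fderiv ℝ g x).hasFDerivAt
  have h1 : ‖(g (y + a) - g y - fderiv ℝ g y a) - (g (y + b) - g y - fderiv ℝ g y b)‖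
      ≤ A * (‖a‖ + ‖b‖) * ‖a - b‖ := by
    refine Convex.norm_image_sub_le_of_norm_hasFDerivWithin_le (𝕜 := ℝ)
      (s := Metric.closedBall 0 (‖a‖ + ‖b‖)) (f := fun c => g (y + c) - g y - fderiv ℝ g y c)
      (fun c _ => (hd y c).hasFDerivWithinAt) (fun c hc => ?_) (convex_closedBall _ _)
      (by simp) (by simp)
    rw [mem_closedBall_zero_iff] at hc
    have := hl.norm_sub_le (y + c) y
    rw [add_sub_cancel_left] at this
    exact this.trans (by gcongr)
  have h2 : ‖((g (y + b) - g y - fderiv ℝ g y b) - (g (z + b) - g z - fderiv ℝ g z b))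
      - ((g (y + 0) - g y - fderiv ℝ g y 0) - (g (z + 0) - g z - fderiv ℝ g z 0))‖
      ≤ A * ‖y - z‖ * ‖b‖ * ‖b - 0‖ := by
    refine Convex.norm_image_sub_le_of_norm_hasFDerivWithin_le (𝕜 := ℝ)
      (s := Metric.closedBall 0 ‖b‖)
      (f := fun c => (g (y + c) - g y - fderiv ℝ g y c) - (g (z + c) - g z - fderiv ℝ g z c))
      (fun c _ => ((hd y c).sub (hd z c)).hasFDerivWithinAt) (fun c hc => ?_)
      (convex_closedBall _ _) (by simp) (by simp)
    rw [mem_closedBall_zero_iff] at hc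
    refine (hl y z c c).trans ?_
    rw [sub_self, norm_zero, zero_add, mul_assoc]
    gcongr
  simp only [add_zero, sub_self, map_zero, sub_zero] at h2
  have := norm_add_le ((g (y + a) - g y - fderiv ℝ g y a) - (g (y + b) - g y - fderiv ℝ g y b))
    ((g (y + b) - g y - fderiv ℝ g y b) - (g (z + b) - g z - fderiv ℝ g z b))
  rw [sub_add_sub_cancel] at this
  refine this.trans ((add_le_add h1 h2).trans (le_of_eq ?_))
  ring

end

variable {E F : Type*} [NormedAddCommGroup E] [NormedSpace ℝ E] [NormedAddCommGroup F]
  [NormedSpace ℝ F]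

/-- The derivative of the coefficient along itself, `Dφ(y) φ(y) ∈ L(E, L(E, F))`: for a solution
`Y` this is the Gubinelli derivative of `φ(Y)`. -/
noncomputable def lieCoeff (φ : F → E →L[ℝ] F) (y : F) : E →L[ℝ] E →L[ℝ] F :=
  (fderiv ℝ φ y).comp (φ y)

/-- The quantitative consequences of `φ ∈ C^{2,1}_b` that enter the estimates, with a common
constant `A`. -/
structure IsRegular (φ : F → E →L[ℝ] F) (A : ℝ) : Prop where
  one_le : 1 ≤ A
  bound : ∀ y, ‖φ y‖ ≤ A
  fourPoint : FourPointLipschitz φ A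
  taylor : ∀ y z a b,
    ‖(φ (y + a) - φ y - fderiv ℝ φ y a) - (φ (z + b) - φ z - fderiv ℝ φ z b)‖
      ≤ A * ((‖a‖ + ‖b‖) * ‖a - b‖ + ‖y - z‖ * ‖b‖ ^ 2)
  bound_lie : ∀ y, ‖lieCoeff φ y‖ ≤ A
  fourPoint_lie : FourPointLipschitz (lieCoeff φ) A

lemma IsRegular.mono {φ : F → E →L[ℝ] F} {A B : ℝ} (h : IsRegular φ A) (hAB : A ≤ B) :
    IsRegular φ B where
  one_le := h.one_le.trans hAB
  bound y := (h.bound y).trans hAB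
  fourPoint := h.fourPoint.mono hAB
  taylor y z a b := (h.taylor y z a b).trans (by gcongr)
  bound_lie y := (h.bound_lie y).trans hAB
  fourPoint_lie := h.fourPoint_lie.mono hAB

lemma IsC21b.exists_isRegular {φ : F → E →L[ℝ] F} (hφ : IsC21b φ) : ∃ A, IsRegular φ A := by
  obtain ⟨K0, h0⟩ := hφ.bounded
  obtain ⟨K1, h1⟩ := hφ.bounded_fderiv
  obtain ⟨K2, h2⟩ := hφ.bounded_fderiv_fderiv
  obtain ⟨K3, h3⟩ := hφ.lipschitz
  set L : ℝ := max (max (max 1 K0) (max K1 K2)) K3 with hL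
  have l0 : K0 ≤ L := by simp [hL]
  have l1 : K1 ≤ L := by simp [hL]
  have l2 : K2 ≤ L := by simp [hL]
  have l3 : (K3 : ℝ) ≤ L := by simp [hL]
  have l4 : 1 ≤ L := by simp [hL]
  have d1 : Differentiable ℝ φ := hφ.contDiff.differentiable (by norm_num)
  have d2 : Differentiable ℝ (fderiv ℝ φ) :=
    (hφ.contDiff.fderiv_right (m := 1) (by norm_num)).differentiable (by norm_num)
  have f1 : FourPointLipschitz (fderiv ℝ φ) L := by
    refine fourPointLipschitz_of_fderiv d2 (fun y => (h2 y).trans l2) fun y z => ?_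
    rw [← dist_eq_norm, ← dist_eq_norm]
    exact (h3.dist_le_mul y z).trans (by gcongr)
  have f0 : FourPointLipschitz φ L :=
    fourPointLipschitz_of_fderiv d1 (fun y => (h1 y).trans l1) fun y z => f1.norm_sub_le y z
  have hLL : L ≤ 4 * L ^ 2 := by nlinarith
  refine ⟨4 * L ^ 2, ⟨by nlinarith, fun y => (h0 y).trans (l0.trans hLL), f0.mono hLL,
    fun y z a b => (norm_taylor_sub_le (by linarith) d1 f1 y z a b).trans (by gcongr),
    fun y => ?_,
    f1.comp f0 (fun y => (h1 y).trans l1) fun y => (h0 y).trans l0⟩⟩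
  refine (ContinuousLinearMap.opNorm_comp_le _ _).trans ?_
  calc _ ≤ L * L := by
        gcongr
        · exact (h1 y).trans l1
        · exact (h0 y).trans l0
    _ ≤ _ := by nlinarith

/-! ### The action of `L(E, L(E, F))` on `E ⊗ E` -/

lemma tensorAct_tmul (B : E →L[ℝ] E →L[ℝ] F) (x y : E) : tensorAct B (x ⊗ₜ y) = B x y := by
  simp [tensorAct]

lemma tensorAct_sub (B B' : E →L[ℝ] E →L[ℝ] F) (ξ : E ⊗[ℝ] E) :
    tensorAct (B - B') ξ = tensorAct B ξ - tensorAct B' ξ := by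
  have : tensorAct (B - B') = tensorAct B - tensorAct B' := by
    apply TensorProduct.ext'
    intro x y
    simp [tensorAct_tmul]
  rw [this, LinearMap.sub_apply]

/-- As `E ⊗ E` is finite-dimensional, its coordinates are bounded in any norm, so the action of
`L(E, L(E, F))` on it is bounded, uniformly in `F`. -/
lemma exists_norm_tensorAct_le [FiniteDimensional ℝ E] (N : CompatibleNorm E) :
    ∃ κ : ℝ, ∀ (B : E →L[ℝ] E →L[ℝ] F) (ξ : E ⊗[ℝ] E),
      ‖tensorAct B ξ‖ ≤ κ * ‖B‖ * N.toSeminorm ξ := by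
  let _ : NormedAddCommGroup (E ⊗[ℝ] E) :=
    AddGroupNorm.toNormedAddCommGroup
      { N.toSeminorm.toAddGroupSeminorm with
        eq_zero_of_map_eq_zero' := fun ξ h => N.eq_zero_of_norm_eq_zero ξ h }
  have hnorm : ∀ ξ : E ⊗[ℝ] E, ‖ξ‖ = N.toSeminorm ξ := fun _ => rfl
  let _ : NormedSpace ℝ (E ⊗[ℝ] E) :=
    { norm_smul_le := fun c ξ => by rw [hnorm, hnorm, map_smul_eq_mul] }
  let b := Module.finBasis ℝ E
  let bb := b.tensorProduct b
  refine ⟨∑ p, ‖LinearMap.toContinuousLinearMap (bb.coord p)‖ * (‖b p.1‖ * ‖b p.2‖),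
    fun B ξ => ?_⟩
  have hξ : tensorAct B ξ = ∑ p, bb.coord p ξ • B (b p.1) (b p.2) := by
    conv_lhs => rw [← bb.sum_repr ξ, map_sum]
    refine Finset.sum_congr rfl fun p _ => ?_
    rw [map_smul, Module.Basis.tensorProduct_apply', tensorAct_tmul, Module.Basis.coord_apply]
  rw [hξ, Finset.sum_mul, Finset.sum_mul]
  refine norm_sum_le_of_le _ fun p _ => ?_
  rw [norm_smul]
  have e1 : ‖bb.coord p ξ‖ ≤ ‖LinearMap.toContinuousLinearMap (bb.coord p)‖ * N.toSeminorm ξ := by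
    rw [← hnorm]
    exact (LinearMap.toContinuousLinearMap (bb.coord p)).le_opNorm ξ
  have e2 : ‖B (b p.1) (b p.2)‖ ≤ ‖B‖ * ‖b p.1‖ * ‖b p.2‖ := B.le_opNorm₂ _ _
  calc _ ≤ (‖LinearMap.toContinuousLinearMap (bb.coord p)‖ * N.toSeminorm ξ)
        * (‖B‖ * ‖b p.1‖ * ‖b p.2‖) := by gcongr
    _ = _ := by ring

/-! ### The remainder of the coefficient along a solution -/

/-- For a solution with `Y_u = y + φ(y) ξ + ρ`, `y = Y_s` and `ξ = X_{s,u}`, this is the remainder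
`φ(Y_u) - φ(Y_s) - (φ(Y))'_s X_{s,u}` of the controlled path `φ(Y)`. -/
noncomputable def coeffRemainder (φ : F → E →L[ℝ] F) (y : F) (ξ : E) (ρ : F) : E →L[ℝ] F :=
  φ (y + φ y ξ + ρ) - φ y - lieCoeff φ y ξ

lemma coeffRemainder_eq (φ : F → E →L[ℝ] F) (y : F) (ξ : E) (ρ : F) :
    coeffRemainder φ y ξ ρ = (φ (y + φ y ξ + ρ) - φ (y + φ y ξ))
      + (φ (y + φ y ξ) - φ y - fderiv ℝ φ y (φ y ξ)) := by
  simp only [coeffRemainder, lieCoeff, ContinuousLinearMap.comp_apply]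
  abel

/-- The bound is linear in `ρ`, since only the part `φ y ξ` of the increment is expanded to second
order. This is what makes the a priori bound for solutions close. -/
lemma IsRegular.norm_coeffRemainder_le {φ : F → E →L[ℝ] F} {A : ℝ} (hφ : IsRegular φ A) (y : F)
    (ξ : E) (ρ : F) : ‖coeffRemainder φ y ξ ρ‖ ≤ A * ‖ρ‖ + A ^ 3 * ‖ξ‖ ^ 2 := by
  have hA : 0 ≤ A := zero_le_one.trans hφ.one_le
  rw [coeffRemainder_eq]
  refine (norm_add_le _ _).trans ?_
  have h1 := hφ.fourPoint.norm_sub_le (y + φ y ξ + ρ) (y + φ y ξ)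
  have h2 := hφ.taylor y y (φ y ξ) 0
  have h3 : ‖φ y ξ‖ ≤ A * ‖ξ‖ := (φ y).le_of_opNorm_le (hφ.bound y) ξ
  simp only [add_sub_cancel_left] at h1
  simp only [add_zero, sub_self, map_zero, sub_zero, norm_zero, zero_mul] at h2
  have h4 : A * (‖φ y ξ‖ * ‖φ y ξ‖) ≤ A * ((A * ‖ξ‖) * (A * ‖ξ‖)) := by gcongr
  nlinarith

lemma IsRegular.norm_apply_sub_apply_le {φ : F → E →L[ℝ] F} {A : ℝ} (hφ : IsRegular φ A) (y z : F)
    (ξ ζ : E) : ‖φ y ξ - φ z ζ‖ ≤ A * (‖y - z‖ * ‖ξ‖ + ‖ξ - ζ‖) := by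
  have e : φ y ξ - φ z ζ = (φ y - φ z) ξ + φ z (ξ - ζ) := by
    simp only [sub_apply, map_sub]; abel
  rw [e]
  refine (norm_add_le _ _).trans ?_
  have h1 := (φ y - φ z).le_of_opNorm_le (hφ.fourPoint.norm_sub_le y z) ξ
  have h2 := (φ z).le_of_opNorm_le (hφ.bound z) (ξ - ζ)
  linarith

lemma IsRegular.norm_coeffRemainder_sub_le {φ : F → E →L[ℝ] F} {A : ℝ} (hφ : IsRegular φ A)
    (y z : F) (ξ ζ : E) (ρ σ : F) :
    ‖coeffRemainder φ y ξ ρ - coeffRemainder φ z ζ σ‖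
      ≤ A * ‖ρ - σ‖ + A * (‖y - z‖ + A * (‖y - z‖ * ‖ξ‖ + ‖ξ - ζ‖)) * ‖σ‖
        + A ^ 3 * ((‖ξ‖ + ‖ζ‖) * (‖y - z‖ * ‖ξ‖ + ‖ξ - ζ‖) + ‖y - z‖ * ‖ζ‖ ^ 2) := by
  have hA : 0 ≤ A := zero_le_one.trans hφ.one_le
  have ha : ‖φ y ξ‖ ≤ A * ‖ξ‖ := (φ y).le_of_opNorm_le (hφ.bound y) ξ
  have hb : ‖φ z ζ‖ ≤ A * ‖ζ‖ := (φ z).le_of_opNorm_le (hφ.bound z) ζ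
  have hab := hφ.norm_apply_sub_apply_le y z ξ ζ
  have h1 := hφ.fourPoint (y + φ y ξ) (z + φ z ζ) ρ σ
  have h2 := hφ.taylor y z (φ y ξ) (φ z ζ)
  have h3 : ‖y + φ y ξ - (z + φ z ζ)‖ ≤ ‖y - z‖ + A * (‖y - z‖ * ‖ξ‖ + ‖ξ - ζ‖) := by
    rw [add_sub_add_comm]
    exact (norm_add_le _ _).trans (by gcongr)
  rw [coeffRemainder_eq, coeffRemainder_eq, add_sub_add_comm]
  refine (norm_add_le _ _).trans ((add_le_add h1 h2).trans ?_)
  calc _ ≤ A * (‖ρ - σ‖ + (‖y - z‖ + A * (‖y - z‖ * ‖ξ‖ + ‖ξ - ζ‖)) * ‖σ‖)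
        + A * ((A * ‖ξ‖ + A * ‖ζ‖) * (A * (‖y - z‖ * ‖ξ‖ + ‖ξ - ζ‖))
          + ‖y - z‖ * (A * ‖ζ‖) ^ 2) := by gcongr
    _ = _ := by ring

/-! ### The germ of the rough integral along a solution -/

variable {N : CompatibleNorm E} {r T : ℝ}

lemma RoughPath.X_self (bX : RoughPath N r T) {s : ℝ} (hs : s ∈ Set.Icc 0 T) : bX.X s s = 0 := by
  simpa using bX.X_add s s s hs.1 le_rfl le_rfl hs.2

lemma RoughPath.XX_self (bX : RoughPath N r T) {s : ℝ} (hs : s ∈ Set.Icc 0 T) : bX.XX s s = 0 := by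
  simpa [bX.X_self hs] using bX.chen s s s hs.1 le_rfl le_rfl hs.2

/-- The germ `φ(Y_s) X_{s,t} + Dφ(Y_s) φ(Y_s) 𝕏_{s,t}`. -/
noncomputable def germ (φ : F → E →L[ℝ] F) (bX : RoughPath N r T) (Y : ℝ → F) (s t : ℝ) : F :=
  φ (Y s) (bX.X s t) + tensorAct (lieCoeff φ (Y s)) (bX.XX s t)

lemma germ_self (φ : F → E →L[ℝ] F) (bX : RoughPath N r T) (Y : ℝ → F) {s : ℝ}
    (hs : s ∈ Set.Icc 0 T) : germ φ bX Y s s = 0 := by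
  simp [germ, bX.X_self hs, bX.XX_self hs]

/-- The defect of additivity of the germ, by Chen's relation. -/
lemma germ_sub_germ_sub_germ (φ : F → E →L[ℝ] F) (bX : RoughPath N r T) (Y : ℝ → F) {s u t : ℝ}
    (hs : 0 ≤ s) (hsu : s ≤ u) (hut : u ≤ t) (ht : t ≤ T) :
    germ φ bX Y s t - germ φ bX Y s u - germ φ bX Y u t =
      -(coeffRemainder φ (Y s) (bX.X s u) (Y u - Y s - φ (Y s) (bX.X s u)) (bX.X u t))
        - tensorAct (lieCoeff φ (Y u) - lieCoeff φ (Y s)) (bX.XX u t) := by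
  have e : Y s + φ (Y s) (bX.X s u) + (Y u - Y s - φ (Y s) (bX.X s u)) = Y u := by abel
  simp only [germ, coeffRemainder, e, tensorAct_sub, bX.X_add s u t hs hsu hut ht,
    bX.chen s u t hs hsu hut ht, map_add, tensorAct_tmul, sub_apply]
  abel

lemma IsSolution.R_eq {φ : F → E →L[ℝ] F} {y₀ : F} {bX : RoughPath N r T}
    {bY : ControlledPath bX F} (h : IsSolution φ y₀ bY) {s : ℝ} (hs : s ∈ Set.Icc 0 T) (t : ℝ) :
    bY.R s t = bY.Y t - bY.Y s - φ (bY.Y s) (bX.X s t) := by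
  rw [ControlledPath.R, remainder, (h s hs).1]

lemma IsSolution.isSewingLimit_zero {φ : F → E →L[ℝ] F} {y₀ : F} {bX : RoughPath N r T}
    {bY : ControlledPath bX F} (h : IsSolution φ y₀ bY) {t : ℝ} (ht : t ∈ Set.Icc 0 T) :
    IsSewingLimit (germ φ bX bY.Y) 0 t (bY.Y t - y₀) := by
  intro ε hε
  obtain ⟨P, hP, h1⟩ := (h t ht).2 ε hε
  refine ⟨P, hP, fun n u hu hu0 hun hPu => ?_⟩
  refine lt_of_eq_of_lt ?_ (h1 n u hu hu0 hun hPu)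
  congr 2
  refine Finset.sum_congr rfl fun i hi => ?_
  rw [Finset.mem_range] at hi
  have hui : u i ∈ Set.Icc 0 T := by
    refine ⟨?_, ?_⟩
    · rw [← hu0]; exact hu.monotoneOn (by simp) (by simp; omega) (Nat.zero_le i)
    · refine le_trans ?_ ht.2
      rw [← hun]; exact hu.monotoneOn (by simp; omega) (by simp) (by omega)
  simp only [germ, lieCoeff, (h (u i) hui).1]

lemma IsSolution.isSewingLimit {φ : F → E →L[ℝ] F} {y₀ : F} {bX : RoughPath N r T}
    {bY : ControlledPath bX F} (h : IsSolution φ y₀ bY) {s t : ℝ} (hs : s ∈ Set.Icc 0 T)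
    (ht : t ∈ Set.Icc 0 T) : IsSewingLimit (germ φ bX bY.Y) s t (bY.Y t - bY.Y s) := by
  have := (h.isSewingLimit_zero hs).of_le hs.1 (h.isSewingLimit_zero ht)
  rwa [sub_sub_sub_cancel_right] at this

lemma IsSolution.Y_zero {φ : F → E →L[ℝ] F} {y₀ : F} {bX : RoughPath N r T}
    {bY : ControlledPath bX F} (h : IsSolution φ y₀ bY) (hT : 0 ≤ T) : bY.Y 0 = y₀ := by
  have h0 : (0 : ℝ) ∈ Set.Icc 0 T := ⟨le_rfl, hT⟩
  have := (h.isSewingLimit_zero h0).norm_sub_le_of_forall (c := 0) (B := 0) le_rfl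
    (fun n u hu h1 h2 => by
      obtain rfl : n = 0 := by
        by_contra hn
        have := hu (a := 0) (b := n) (by simp) (by simp) (by omega)
        linarith
      simp)
  rw [sub_zero] at this
  exact sub_eq_zero.1 (norm_le_zero_iff.1 this)

/-! ### Pointwise estimates in terms of a gauge -/

/-- A solution, together with gauge bounds for the driving rough path and for the remainder. -/
structure BoundedSolution (φ : F → E →L[ℝ] F) (h : ℝ → ℝ → ℝ) (I : Set ℝ) (y₀ : F)
    {bX : RoughPath N r T} (bY : ControlledPath bX F) (x xx ρ : ℝ) : Prop where
  sol : IsSolution φ y₀ bY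
  x_nonneg : 0 ≤ x
  xx_nonneg : 0 ≤ xx
  ρ_nonneg : 0 ≤ ρ
  X_le : GaugeBound h I (fun s t => ‖bX.X s t‖) x 1
  XX_le : GaugeBound h I (fun s t => N.toSeminorm (bX.XX s t)) xx 2
  R_le : GaugeBound h I (fun s t => ‖bY.R s t‖) ρ 2

/-- The constant `A` dominates the constants of the coefficient, of the action on `E ⊗ E` and of the
sewing estimate. -/
structure Dominates (N : CompatibleNorm E) (r : ℝ) (φ : F → E →L[ℝ] F) (A : ℝ) : Prop where
  r_pos : 0 < r
  r_lt : r < 3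
  regular : IsRegular φ A
  tensorAct_le : ∀ (B : E →L[ℝ] E →L[ℝ] F) (ξ : E ⊗[ℝ] E),
    ‖tensorAct B ξ‖ ≤ A * ‖B‖ * N.toSeminorm ξ
  sewing_le : sewingConst r ≤ A

section

variable {φ : F → E →L[ℝ] F} {A : ℝ} {h : ℝ → ℝ → ℝ} {I : Set ℝ} {y₀ yt₀ : F}
  {bX bXt : RoughPath N r T} {bY : ControlledPath bX F} {bYt : ControlledPath bXt F}
  {x xx ρ xt xxt ρt dx dxx dρ M : ℝ}

lemma BoundedSolution.norm_increment_le (hD : Dominates N r φ A) (hIT : I ⊆ Set.Icc 0 T)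
    (H : IsGauge r h I) (S : BoundedSolution φ h I y₀ bY x xx ρ) {s t : ℝ} (hs : s ∈ I)
    (ht : t ∈ I) (hst : s ≤ t) : ‖bY.Y t - bY.Y s‖ ≤ (A * x + ρ) * h s t := by
  have e : bY.Y t - bY.Y s = φ (bY.Y s) (bX.X s t) + bY.R s t := by
    rw [S.sol.R_eq (hIT hs)]; abel
  rw [e]
  refine (norm_add_le _ _).trans ?_
  have h1 := (φ (bY.Y s)).le_of_opNorm_le (hD.regular.bound _) (bX.X s t)
  have h2 := S.X_le s hs t ht hst
  have h3 := S.R_le s hs t ht hst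
  have h4 := H.nonneg s t
  have h5 := H.le_one s hs t ht hst
  have h6 : h s t ^ 2 ≤ h s t := by nlinarith
  have hA : 0 ≤ A := zero_le_one.trans hD.regular.one_le
  beta_reduce at h2 h3
  rw [pow_one] at h2
  calc _ ≤ A * (x * h s t) + ρ * h s t := by
        refine add_le_add (h1.trans (by gcongr)) (h3.trans ?_)
        have := S.ρ_nonneg
        gcongr
    _ = _ := by ring

lemma BoundedSolution.norm_coeffRemainder_le (hD : Dominates N r φ A)
    (S : BoundedSolution φ h I y₀ bY x xx ρ) {s t : ℝ} (hs : s ∈ I)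
    (ht : t ∈ I) (hst : s ≤ t) :
    ‖coeffRemainder φ (bY.Y s) (bX.X s t) (bY.R s t)‖ ≤ (A * ρ + A ^ 3 * x ^ 2) * h s t ^ 2 := by
  have h2 := S.X_le s hs t ht hst
  have h3 := S.R_le s hs t ht hst
  have hA : 0 ≤ A := zero_le_one.trans hD.regular.one_le
  beta_reduce at h2 h3
  rw [pow_one] at h2
  refine (hD.regular.norm_coeffRemainder_le _ _ _).trans ?_
  calc _ ≤ A * (ρ * h s t ^ 2) + A ^ 3 * (x * h s t) ^ 2 := by gcongr
    _ = _ := by ring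

/-- The a priori estimate, before absorption of `ρ` into the left-hand side. -/
lemma BoundedSolution.gaugeBound_R (hD : Dominates N r φ A) (hI : I.OrdConnected)
    (hIT : I ⊆ Set.Icc 0 T) (H : IsGauge r h I) (S : BoundedSolution φ h I y₀ bY x xx ρ) :
    GaugeBound h I (fun s t => ‖bY.R s t‖)
      (A ^ 2 * xx + A * (x * (A * ρ + A ^ 3 * x ^ 2) + A ^ 2 * (A * x + ρ) * xx)) 2 := by
  have hA : 0 ≤ A := zero_le_one.trans hD.regular.one_le
  have hx := S.x_nonneg
  have hxx := S.xx_nonneg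
  have hρ := S.ρ_nonneg
  intro s hs t ht hst
  have hsew := (S.sol.isSewingLimit (hIT hs) (hIT ht)).norm_sub_le hD.r_pos hD.r_lt hI H
    (D := x * (A * ρ + A ^ 3 * x ^ 2) + A ^ 2 * (A * x + ρ) * xx) (by positivity)
    (fun s hs => germ_self φ bX bY.Y (hIT hs)) (fun s hs u hu t ht hsu hut => by
      rw [germ_sub_germ_sub_germ φ bX bY.Y (hIT hs).1 hsu hut (hIT ht).2, ← S.sol.R_eq (hIT hs)]
      have e1 := S.norm_coeffRemainder_le hD hs hu hsu
      have e2 := S.X_le u hu t ht hut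
      have e3 := S.XX_le u hu t ht hut
      have e4 := S.norm_increment_le hD hIT H hs hu hsu
      have e5 := hD.regular.fourPoint_lie.norm_sub_le (bY.Y u) (bY.Y s)
      have m1 := H.le_right hD.r_pos hs hu ht hsu hut
      have m2 := H.le_left hD.r_pos hs hu ht hsu hut
      have p1 := H.nonneg s u
      have p2 := H.nonneg u t
      have p3 := H.nonneg s t
      beta_reduce at e2 e3
      rw [pow_one] at e2
      have f1 := (coeffRemainder φ (bY.Y s) (bX.X s u) (bY.R s u)).le_of_opNorm_le e1 (bX.X u t)
      have f2 := hD.tensorAct_le (lieCoeff φ (bY.Y u) - lieCoeff φ (bY.Y s)) (bX.XX u t)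
      refine (norm_sub_le _ _).trans ?_
      rw [norm_neg]
      calc _ ≤ (A * ρ + A ^ 3 * x ^ 2) * h s t ^ 2 * (x * h s t)
            + A * (A * ((A * x + ρ) * h s t)) * (xx * h s t ^ 2) := by
            refine add_le_add (f1.trans ?_) (f2.trans ?_)
            · gcongr
              exact e2.trans (by gcongr)
            · gcongr
              · exact e5.trans (by gcongr; exact e4.trans (by gcongr))
              · exact e3.trans (by gcongr)
        _ = _ := by ring) hs ht hst
  have e : bY.R s t = (bY.Y t - bY.Y s - germ φ bX bY.Y s t)
      + tensorAct (lieCoeff φ (bY.Y s)) (bX.XX s t) := by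
    rw [S.sol.R_eq (hIT hs), germ]; abel
  have f1 := hD.tensorAct_le (lieCoeff φ (bY.Y s)) (bX.XX s t)
  have f2 := hD.regular.bound_lie (bY.Y s)
  have f3 := S.XX_le s hs t ht hst
  have h4 := H.nonneg s t
  have h5 := H.le_one s hs t ht hst
  have h6 : h s t ^ 3 ≤ h s t ^ 2 := pow_le_pow_of_le_one h4 h5 (by norm_num)
  have h7 := sewingConst_pos hD.r_pos hD.r_lt
  have h8 := hD.sewing_le
  beta_reduce at f3 ⊢
  rw [e]
  refine (norm_add_le _ _).trans ?_
  calc _ ≤ A * (x * (A * ρ + A ^ 3 * x ^ 2) + A ^ 2 * (A * x + ρ) * xx) * h s t ^ 2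
        + A * A * (xx * h s t ^ 2) := by
        refine add_le_add (hsew.trans (by gcongr)) (f1.trans ?_)
        gcongr
    _ = _ := by ring

/-- Two solutions, together with gauge bounds for the differences of their data, and a bound `M` for
the distance between them. -/
structure BoundedPair (φ : F → E →L[ℝ] F) (h : ℝ → ℝ → ℝ) (I : Set ℝ) (y₀ yt₀ : F)
    {bX bXt : RoughPath N r T} (bY : ControlledPath bX F) (bYt : ControlledPath bXt F)
    (x xx ρ xt xxt ρt dx dxx dρ M : ℝ) : Prop where
  left : BoundedSolution φ h I y₀ bY x xx ρ
  right : BoundedSolution φ h I yt₀ bYt xt xxt ρt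
  dx_nonneg : 0 ≤ dx
  dxx_nonneg : 0 ≤ dxx
  dρ_nonneg : 0 ≤ dρ
  M_nonneg : 0 ≤ M
  dX_le : GaugeBound h I (fun s t => ‖bX.X s t - bXt.X s t‖) dx 1
  dXX_le : GaugeBound h I (fun s t => N.toSeminorm (bX.XX s t - bXt.XX s t)) dxx 2
  dR_le : GaugeBound h I (fun s t => ‖bY.R s t - bYt.R s t‖) dρ 2
  dY_le : ∀ s ∈ I, ‖bY.Y s - bYt.Y s‖ ≤ M

lemma BoundedPair.norm_increment_sub_le (hD : Dominates N r φ A) (hIT : I ⊆ Set.Icc 0 T)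
    (H : IsGauge r h I) (S : BoundedPair φ h I y₀ yt₀ bY bYt x xx ρ xt xxt ρt dx dxx dρ M)
    {s t : ℝ} (hs : s ∈ I) (ht : t ∈ I) (hst : s ≤ t) :
    ‖(bY.Y t - bY.Y s) - (bYt.Y t - bYt.Y s)‖ ≤ (A * (M * x + dx) + dρ) * h s t := by
  have e : (bY.Y t - bY.Y s) - (bYt.Y t - bYt.Y s)
      = (φ (bY.Y s) (bX.X s t) - φ (bYt.Y s) (bXt.X s t)) + (bY.R s t - bYt.R s t) := by
    rw [S.left.sol.R_eq (hIT hs), S.right.sol.R_eq (hIT hs)]; abel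
  rw [e]
  refine (norm_add_le _ _).trans ?_
  have h1 := hD.regular.norm_apply_sub_apply_le (bY.Y s) (bYt.Y s) (bX.X s t) (bXt.X s t)
  have h2 := S.left.X_le s hs t ht hst
  have h2' := S.dX_le s hs t ht hst
  have h3 := S.dR_le s hs t ht hst
  have h3' := S.dY_le s hs
  have h4 := H.nonneg s t
  have h5 := H.le_one s hs t ht hst
  have h6 : h s t ^ 2 ≤ h s t := by nlinarith
  have hA : 0 ≤ A := zero_le_one.trans hD.regular.one_le
  have hM := S.M_nonneg
  have hd := S.dρ_nonneg
  beta_reduce at h2 h2' h3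
  rw [pow_one] at h2 h2'
  calc _ ≤ A * (M * (x * h s t) + dx * h s t) + dρ * h s t :=
        add_le_add (h1.trans (by gcongr)) (h3.trans (by gcongr))
    _ = _ := by ring

lemma BoundedPair.norm_coeffRemainder_sub_le (hD : Dominates N r φ A)
    (H : IsGauge r h I) (S : BoundedPair φ h I y₀ yt₀ bY bYt x xx ρ xt xxt ρt dx dxx dρ M)
    {s t : ℝ} (hs : s ∈ I) (ht : t ∈ I) (hst : s ≤ t) :
    ‖coeffRemainder φ (bY.Y s) (bX.X s t) (bY.R s t)
        - coeffRemainder φ (bYt.Y s) (bXt.X s t) (bYt.R s t)‖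
      ≤ (A * dρ + A * (M + A * (M * x + dx)) * ρt
        + A ^ 3 * ((x + xt) * (M * x + dx) + M * xt ^ 2)) * h s t ^ 2 := by
  have h1 := S.left.X_le s hs t ht hst
  have h2 := S.right.X_le s hs t ht hst
  have h3 := S.dX_le s hs t ht hst
  have h4 := S.dR_le s hs t ht hst
  have h5 := S.right.R_le s hs t ht hst
  have h6 := S.dY_le s hs
  have h7 := H.nonneg s t
  have h8 := H.le_one s hs t ht hst
  have hA : 0 ≤ A := zero_le_one.trans hD.regular.one_le
  have hM := S.M_nonneg
  have hx := S.left.x_nonneg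
  have hxt := S.right.x_nonneg
  have hd := S.dx_nonneg
  have hρ := S.right.ρ_nonneg
  beta_reduce at h1 h2 h3 h4 h5
  rw [pow_one] at h1 h2 h3
  refine (hD.regular.norm_coeffRemainder_sub_le _ _ _ _ _ _).trans ?_
  calc _ ≤ A * (dρ * h s t ^ 2) + A * (M + A * (M * (x * 1) + dx * 1)) * (ρt * h s t ^ 2)
        + A ^ 3 * ((x * h s t + xt * h s t) * (M * (x * h s t) + dx * h s t)
          + M * (xt * h s t) ^ 2) := by
        gcongr
        · exact h1.trans (by gcongr)
        · exact h3.trans (by gcongr)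
    _ = _ := by ring

/-- The estimate of the difference of two remainders, before absorption. -/
lemma BoundedPair.gaugeBound_R_sub (hD : Dominates N r φ A) (hI : I.OrdConnected)
    (hIT : I ⊆ Set.Icc 0 T) (H : IsGauge r h I)
    (S : BoundedPair φ h I y₀ yt₀ bY bYt x xx ρ xt xxt ρt dx dxx dρ M) :
    GaugeBound h I (fun s t => ‖bY.R s t - bYt.R s t‖)
      (A ^ 2 * (M * xx + dxx)
        + A * ((A * dρ + A * (M + A * (M * x + dx)) * ρt
            + A ^ 3 * ((x + xt) * (M * x + dx) + M * xt ^ 2)) * x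
          + (A * ρt + A ^ 3 * xt ^ 2) * dx
          + A ^ 2 * ((A * (M * x + dx) + dρ) + M * (A * xt + ρt)) * xx
          + A ^ 2 * (A * xt + ρt) * dxx)) 2 := by
  have hA : 0 ≤ A := zero_le_one.trans hD.regular.one_le
  have hx := S.left.x_nonneg
  have hxx := S.left.xx_nonneg
  have hxt := S.right.x_nonneg
  have hρt := S.right.ρ_nonneg
  have hdx := S.dx_nonneg
  have hdxx := S.dxx_nonneg
  have hdρ := S.dρ_nonneg
  have hM := S.M_nonneg
  intro s hs t ht hst
  have hsew := ((S.left.sol.isSewingLimit (hIT hs) (hIT ht)).sub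
      (S.right.sol.isSewingLimit (hIT hs) (hIT ht))).norm_sub_le hD.r_pos hD.r_lt hI H
    (D := (A * dρ + A * (M + A * (M * x + dx)) * ρt
            + A ^ 3 * ((x + xt) * (M * x + dx) + M * xt ^ 2)) * x
          + (A * ρt + A ^ 3 * xt ^ 2) * dx
          + A ^ 2 * ((A * (M * x + dx) + dρ) + M * (A * xt + ρt)) * xx
          + A ^ 2 * (A * xt + ρt) * dxx) (by positivity)
    (fun s hs => by simp [germ_self φ bX bY.Y (hIT hs), germ_self φ bXt bYt.Y (hIT hs)])
    (fun s hs u hu t ht hsu hut => by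
      have g1 := germ_sub_germ_sub_germ φ bX bY.Y (hIT hs).1 hsu hut (hIT ht).2
      have g2 := germ_sub_germ_sub_germ φ bXt bYt.Y (hIT hs).1 hsu hut (hIT ht).2
      rw [← S.left.sol.R_eq (hIT hs)] at g1
      rw [← S.right.sol.R_eq (hIT hs)] at g2
      have g : (germ φ bX bY.Y - germ φ bXt bYt.Y) s t - (germ φ bX bY.Y - germ φ bXt bYt.Y) s u
          - (germ φ bX bY.Y - germ φ bXt bYt.Y) u t
          = -((coeffRemainder φ (bY.Y s) (bX.X s u) (bY.R s u)
                - coeffRemainder φ (bYt.Y s) (bXt.X s u) (bYt.R s u)) (bX.X u t))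
            - (coeffRemainder φ (bYt.Y s) (bXt.X s u) (bYt.R s u)) (bX.X u t - bXt.X u t)
            - tensorAct ((lieCoeff φ (bY.Y u) - lieCoeff φ (bY.Y s))
                - (lieCoeff φ (bYt.Y u) - lieCoeff φ (bYt.Y s))) (bX.XX u t)
            - tensorAct (lieCoeff φ (bYt.Y u) - lieCoeff φ (bYt.Y s))
                (bX.XX u t - bXt.XX u t) := by
        have : (germ φ bX bY.Y - germ φ bXt bYt.Y) s t
            - (germ φ bX bY.Y - germ φ bXt bYt.Y) s u - (germ φ bX bY.Y - germ φ bXt bYt.Y) u t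
            = (germ φ bX bY.Y s t - germ φ bX bY.Y s u - germ φ bX bY.Y u t)
              - (germ φ bXt bYt.Y s t - germ φ bXt bYt.Y s u - germ φ bXt bYt.Y u t) := by
          simp only [Pi.sub_apply]; abel
        rw [this, g1, g2, tensorAct_sub (lieCoeff φ (bY.Y u) - lieCoeff φ (bY.Y s))]
        simp only [sub_apply, map_sub]
        abel
      rw [g]
      have e1 := S.norm_coeffRemainder_sub_le hD H hs hu hsu
      have e1' := S.right.norm_coeffRemainder_le hD hs hu hsu
      have e2 := S.left.X_le u hu t ht hut
      have e2' := S.dX_le u hu t ht hut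
      have e3 := S.left.XX_le u hu t ht hut
      have e3' := S.dXX_le u hu t ht hut
      have e4 := S.norm_increment_sub_le hD hIT H hs hu hsu
      have e4' := S.right.norm_increment_le hD hIT H hs hu hsu
      have e5 := hD.regular.fourPoint_lie (bY.Y s) (bYt.Y s) (bY.Y u - bY.Y s)
        (bYt.Y u - bYt.Y s)
      rw [add_sub_cancel, add_sub_cancel] at e5
      have e5' := hD.regular.fourPoint_lie.norm_sub_le (bYt.Y u) (bYt.Y s)
      have e6 := S.dY_le s hs
      have m1 := H.le_right hD.r_pos hs hu ht hsu hut
      have m2 := H.le_left hD.r_pos hs hu ht hsu hut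
      have p1 := H.nonneg s u
      have p2 := H.nonneg u t
      have p3 := H.nonneg s t
      beta_reduce at e2 e2' e3 e3'
      rw [pow_one] at e2 e2'
      have f1 := (coeffRemainder φ (bY.Y s) (bX.X s u) (bY.R s u)
        - coeffRemainder φ (bYt.Y s) (bXt.X s u) (bYt.R s u)).le_of_opNorm_le e1 (bX.X u t)
      have f2 := (coeffRemainder φ (bYt.Y s) (bXt.X s u) (bYt.R s u)).le_of_opNorm_le e1'
        (bX.X u t - bXt.X u t)
      have f3 := hD.tensorAct_le ((lieCoeff φ (bY.Y u) - lieCoeff φ (bY.Y s))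
                - (lieCoeff φ (bYt.Y u) - lieCoeff φ (bYt.Y s))) (bX.XX u t)
      have f4 := hD.tensorAct_le (lieCoeff φ (bYt.Y u) - lieCoeff φ (bYt.Y s))
        (bX.XX u t - bXt.XX u t)
      refine (norm_sub_le _ _).trans ((add_le_add_left ((norm_sub_le _ _).trans
        (add_le_add_left (norm_sub_le _ _) _)) _).trans ?_)
      rw [norm_neg]
      calc _ ≤ (A * dρ + A * (M + A * (M * x + dx)) * ρt
              + A ^ 3 * ((x + xt) * (M * x + dx) + M * xt ^ 2)) * h s t ^ 2 * (x * h s t)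
            + (A * ρt + A ^ 3 * xt ^ 2) * h s t ^ 2 * (dx * h s t)
            + A * (A * ((A * (M * x + dx) + dρ) * h s t + M * ((A * xt + ρt) * h s t)))
              * (xx * h s t ^ 2)
            + A * (A * ((A * xt + ρt) * h s t)) * (dxx * h s t ^ 2) := by
            refine add_le_add (add_le_add (add_le_add (f1.trans ?_) (f2.trans ?_)) (f3.trans ?_))
              (f4.trans ?_)
            · gcongr
              exact e2.trans (by gcongr)
            · gcongr
              exact e2'.trans (by gcongr)
            · gcongr
              · refine e5.trans ?_
                gcongr
                · exact e4.trans (by gcongr)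
                · exact e4'.trans (by gcongr)
              · exact e3.trans (by gcongr)
            · gcongr
              · exact e5'.trans (by gcongr; exact e4'.trans (by gcongr))
              · exact e3'.trans (by gcongr)
        _ = _ := by ring) hs ht hst
  have e : bY.R s t - bYt.R s t
      = ((bY.Y t - bY.Y s) - (bYt.Y t - bYt.Y s) - (germ φ bX bY.Y - germ φ bXt bYt.Y) s t)
      + (tensorAct (lieCoeff φ (bY.Y s) - lieCoeff φ (bYt.Y s)) (bX.XX s t)
        + tensorAct (lieCoeff φ (bYt.Y s)) (bX.XX s t - bXt.XX s t)) := by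
    rw [S.left.sol.R_eq (hIT hs), S.right.sol.R_eq (hIT hs), tensorAct_sub]
    simp only [Pi.sub_apply, germ, map_sub]
    abel
  have f1 := hD.tensorAct_le (lieCoeff φ (bY.Y s) - lieCoeff φ (bYt.Y s)) (bX.XX s t)
  have f1' := hD.tensorAct_le (lieCoeff φ (bYt.Y s)) (bX.XX s t - bXt.XX s t)
  have f2 := hD.regular.fourPoint_lie.norm_sub_le (bY.Y s) (bYt.Y s)
  have f2' := hD.regular.bound_lie (bYt.Y s)
  have f3 := S.left.XX_le s hs t ht hst
  have f3' := S.dXX_le s hs t ht hst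
  have f4 := S.dY_le s hs
  have h4 := H.nonneg s t
  have h5 := H.le_one s hs t ht hst
  have h6 : h s t ^ 3 ≤ h s t ^ 2 := pow_le_pow_of_le_one h4 h5 (by norm_num)
  have h7 := sewingConst_pos hD.r_pos hD.r_lt
  have h8 := hD.sewing_le
  beta_reduce at f3 f3' ⊢
  rw [e]
  refine (norm_add_le _ _).trans ((add_le_add_right (norm_add_le _ _) _).trans ?_)
  calc _ ≤ A * ((A * dρ + A * (M + A * (M * x + dx)) * ρt
            + A ^ 3 * ((x + xt) * (M * x + dx) + M * xt ^ 2)) * x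
          + (A * ρt + A ^ 3 * xt ^ 2) * dx
          + A ^ 2 * ((A * (M * x + dx) + dρ) + M * (A * xt + ρt)) * xx
          + A ^ 2 * (A * xt + ρt) * dxx) * h s t ^ 2
        + (A * (A * M) * (xx * h s t ^ 2) + A * A * (dxx * h s t ^ 2)) := by
        refine add_le_add (hsew.trans (by gcongr)) (add_le_add (f1.trans ?_) (f1'.trans ?_))
        · gcongr
          exact f2.trans (by gcongr)
        · gcongr
    _ = _ := by ring

end

/-! ### Real-valued variations of the data -/

/-- `V^r X_I` as a real number. -/
noncomputable def RoughPath.varX (bX : RoughPath N r T) (I : Set ℝ) : ℝ :=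
  realVariation r 1 (fun s t => ‖bX.X s t‖) I

/-- `V^{r/2} 𝕏_I` as a real number. -/
noncomputable def RoughPath.varXX (bX : RoughPath N r T) (I : Set ℝ) : ℝ :=
  realVariation r 2 (fun s t => N.toSeminorm (bX.XX s t)) I

/-- `V^r (ΔX)_I` as a real number. -/
noncomputable def RoughPath.varXSub (bX bXt : RoughPath N r T) (I : Set ℝ) : ℝ :=
  realVariation r 1 (fun s t => ‖bX.X s t - bXt.X s t‖) I

/-- `V^{r/2} (Δ𝕏)_I` as a real number. -/
noncomputable def RoughPath.varXXSub (bX bXt : RoughPath N r T) (I : Set ℝ) : ℝ :=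
  realVariation r 2 (fun s t => N.toSeminorm (bX.XX s t - bXt.XX s t)) I

/-- `V^{r/2} R_I` as a real number. -/
noncomputable def ControlledPath.varR {bX : RoughPath N r T} (bY : ControlledPath bX F)
    (I : Set ℝ) : ℝ :=
  realVariation r 2 (fun s t => ‖bY.R s t‖) I

/-- `V^{r/2} (ΔR)_I` as a real number. -/
noncomputable def ControlledPath.varRSub {bX bXt : RoughPath N r T} (bY : ControlledPath bX F)
    (bYt : ControlledPath bXt F) (I : Set ℝ) : ℝ :=
  realVariation r 2 (fun s t => ‖bY.R s t - bYt.R s t‖) I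

lemma normVariation_eq_one {G : Type*} [NormedAddCommGroup G] (r : ℝ) (Z : ℝ → ℝ → G) (I : Set ℝ) :
    normVariation r Z I
      = variation (r / (1 : ℕ)) (fun s t => ENNReal.ofReal ‖Z s t‖) I := by
  simp [normVariation, ofReal_norm]

lemma normVariation_eq_two {G : Type*} [NormedAddCommGroup G] (r : ℝ) (Z : ℝ → ℝ → G) (I : Set ℝ) :
    normVariation (r / 2) Z I
      = variation (r / (2 : ℕ)) (fun s t => ENNReal.ofReal ‖Z s t‖) I := by
  simp [normVariation, ofReal_norm]

lemma RoughPath.finiteVariation_X (bX : RoughPath N r T) :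
    FiniteVariation r 1 (fun s t => ‖bX.X s t‖) (Set.Icc 0 T) := by
  have := bX.variation_X
  rwa [normVariation_eq_one] at this

lemma RoughPath.finiteVariation_XX (bX : RoughPath N r T) :
    FiniteVariation r 2 (fun s t => N.toSeminorm (bX.XX s t)) (Set.Icc 0 T) := by
  have := bX.variation_XX
  simpa [FiniteVariation, tensorVariation] using this

lemma ControlledPath.finiteVariation_R {bX : RoughPath N r T} (bY : ControlledPath bX F) :
    FiniteVariation r 2 (fun s t => ‖bY.R s t‖) (Set.Icc 0 T) := by
  have := bY.variation_remainder
  rwa [normVariation_eq_two] at this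

lemma ControlledPath.R_self {bX : RoughPath N r T} (bY : ControlledPath bX F) {s : ℝ}
    (hs : s ∈ Set.Icc 0 T) : bY.R s s = 0 := by
  simp [ControlledPath.R, remainder, bX.X_self hs]

lemma RoughPath.finiteVariation_X_sub (h2 : 2 ≤ r) (bX bXt : RoughPath N r T) :
    FiniteVariation r 1 (fun s t => ‖bX.X s t - bXt.X s t‖) (Set.Icc 0 T) :=
  FiniteVariation.of_le_add one_pos (by push_cast; linarith) bX.finiteVariation_X
    bXt.finiteVariation_X (fun _ hs => by simp [bX.X_self hs]) (fun _ hs => by simp [bXt.X_self hs])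
    fun _ _ => norm_sub_le _ _

lemma RoughPath.finiteVariation_XX_sub (h2 : 2 ≤ r) (bX bXt : RoughPath N r T) :
    FiniteVariation r 2 (fun s t => N.toSeminorm (bX.XX s t - bXt.XX s t)) (Set.Icc 0 T) :=
  FiniteVariation.of_le_add two_pos (by push_cast; linarith) bX.finiteVariation_XX
    bXt.finiteVariation_XX (fun _ hs => by simp [bX.XX_self hs])
    (fun _ hs => by simp [bXt.XX_self hs]) fun _ _ => map_sub_le_add _ _ _

lemma ControlledPath.finiteVariation_R_sub (h2 : 2 ≤ r) {bX bXt : RoughPath N r T}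
    (bY : ControlledPath bX F) (bYt : ControlledPath bXt F) :
    FiniteVariation r 2 (fun s t => ‖bY.R s t - bYt.R s t‖) (Set.Icc 0 T) :=
  FiniteVariation.of_le_add two_pos (by push_cast; linarith) bY.finiteVariation_R
    bYt.finiteVariation_R (fun _ hs => by simp [bY.R_self hs])
    (fun _ hs => by simp [bYt.R_self hs]) fun _ _ => norm_sub_le _ _

/-! ### A priori bound for one solution -/

section

variable {φ : F → E →L[ℝ] F} {A : ℝ} {I : Set ℝ} {y₀ yt₀ : F}
  {bX bXt : RoughPath N r T} {bY : ControlledPath bX F} {bYt : ControlledPath bXt F}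

/-- The factor `3` is the number of functions that share the gauge. -/
lemma IsSolution.exists_boundedSolution (h2 : 2 ≤ r) (hIT : I ⊆ Set.Icc 0 T)
    (hsol : IsSolution φ y₀ bY) :
    ∃ h, IsGauge r h I ∧
      BoundedSolution φ h I y₀ bY (3 * bX.varX I) (3 * bX.varXX I) (3 * bY.varR I) := by
  obtain ⟨h, H, hle⟩ := exists_gauge (ι := Fin 3) (r := r) (by linarith) ![1, 2, 2]
    (by intro k; fin_cases k <;> norm_num)
    (by intro k; fin_cases k <;> norm_num <;> linarith)
    ![fun s t => ‖bX.X s t‖, fun s t => N.toSeminorm (bX.XX s t), fun s t => ‖bY.R s t‖] I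
    (by
      intro k s hs
      fin_cases k <;> simp [bX.X_self (hIT hs), bX.XX_self (hIT hs), bY.R_self (hIT hs)])
    (by
      intro k
      fin_cases k
      · exact bX.finiteVariation_X.mono hIT
      · exact bX.finiteVariation_XX.mono hIT
      · exact bY.finiteVariation_R.mono hIT)
  have e : (Fintype.card (Fin 3) : ℝ) = 3 := by simp
  rw [e] at hle
  exact ⟨h, H, hsol, mul_nonneg (by norm_num) (realVariation_nonneg _ _ _ _),
    mul_nonneg (by norm_num) (realVariation_nonneg _ _ _ _),
    mul_nonneg (by norm_num) (realVariation_nonneg _ _ _ _), hle 0, hle 1, hle 2⟩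

lemma IsSolution.exists_norm_le (h2 : 2 ≤ r) (hT : 0 ≤ T) (hD : Dominates N r φ A)
    (hsol : IsSolution φ y₀ bY) : ∃ M, ∀ t ∈ Set.Icc 0 T, ‖bY.Y t‖ ≤ M := by
  obtain ⟨h, H, S⟩ := hsol.exists_boundedSolution h2 subset_rfl
  have h0 : (0 : ℝ) ∈ Set.Icc 0 T := ⟨le_rfl, hT⟩
  refine ⟨‖bY.Y 0‖ + (A * (3 * bX.varX (Set.Icc 0 T)) + 3 * bY.varR (Set.Icc 0 T)),
    fun t ht => ?_⟩
  have h1 := S.norm_increment_le hD subset_rfl H h0 ht ht.1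
  have h3 := S.x_nonneg
  have h4 := S.ρ_nonneg
  have hA : 0 ≤ A := zero_le_one.trans hD.regular.one_le
  have h5 := mul_le_of_le_one_right (a := A * (3 * bX.varX (Set.Icc 0 T))
    + 3 * bY.varR (Set.Icc 0 T)) (by positivity) (H.le_one 0 h0 t ht ht.1)
  have h6 := norm_add_le (bY.Y 0) (bY.Y t - bY.Y 0)
  rw [add_sub_cancel] at h6
  linarith

/-- The a priori bound. The smallness of the data allows to absorb the terms with `bY.varR I` on the
right-hand side of `BoundedSolution.gaugeBound_R`. -/
lemma IsSolution.varR_le (h2 : 2 ≤ r) (hD : Dominates N r φ A) (hI : I.OrdConnected)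
    (hIT : I ⊆ Set.Icc 0 T) (hsol : IsSolution φ y₀ bY) (hX : bX.varX I ≤ 1 / (36 * A ^ 3))
    (hXX : bX.varXX I ≤ 1 / (36 * A ^ 3)) :
    bY.varR I ≤ 36 * A ^ 4 * (bX.varX I ^ 2 + bX.varXX I) := by
  obtain ⟨h, H, S⟩ := hsol.exists_boundedSolution h2 hIT
  have hA := hD.regular.one_le
  have hx0 : 0 ≤ bX.varX I := realVariation_nonneg _ _ _ _
  have hxx0 : 0 ≤ bX.varXX I := realVariation_nonneg _ _ _ _
  have hρ0 : 0 ≤ bY.varR I := realVariation_nonneg _ _ _ _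
  have key : bY.varR I ≤ _ := H.realVariation_le hD.r_pos two_pos (by positivity)
    (S.gaugeBound_R hD hI hIT H)
  revert key hx0 hxx0 hρ0 hX hXX
  generalize bX.varX I = x
  generalize bX.varXX I = xx
  generalize bY.varR I = ρ
  intro hX hXX hx0 hxx0 hρ0 key
  have hA3 : 1 ≤ A ^ 3 := one_le_pow₀ hA
  rw [le_div_iff₀ (by positivity)] at hX hXX
  have hx1 : 3 * x ≤ 1 := by nlinarith
  have c1 : A ^ 2 * (3 * xx) ≤ A ^ 4 * (3 * xx) := by gcongr ; norm_num
  have c2 : A * (3 * x * (A * (3 * ρ))) ≤ A ^ 3 * (9 * (x * ρ)) := by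
    have : A ^ 2 ≤ A ^ 3 := pow_le_pow_right₀ hA (by norm_num)
    calc _ = A ^ 2 * (9 * (x * ρ)) := by ring
      _ ≤ _ := by gcongr
  have c3 : A * (3 * x * (A ^ 3 * (3 * x) ^ 2)) ≤ A ^ 4 * (9 * x ^ 2) := by
    calc _ = A ^ 4 * (9 * x ^ 2) * (3 * x) := by ring
      _ ≤ _ := mul_le_of_le_one_right (by positivity) hx1
  have c4 : A * (A ^ 2 * (A * (3 * x)) * (3 * xx)) ≤ A ^ 4 * (3 * xx) := by
    calc _ = A ^ 4 * (3 * xx) * (3 * x) := by ring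
      _ ≤ _ := mul_le_of_le_one_right (by positivity) hx1
  have c5 : A ^ 3 * (9 * ((x + xx) * ρ)) ≤ ρ / 2 := by
    have : (36 * A ^ 3 * (x + xx)) * ρ ≤ 2 * ρ := by gcongr; linarith
    linarith
  nlinarith [mul_nonneg (by positivity : 0 ≤ A ^ 4) (by positivity : 0 ≤ x ^ 2 + xx)]

end

/-! ### The difference of two solutions -/

/-- The right-hand side of the local Lipschitz estimate for the remainder. -/
def lipschitzBound (M x xx xt xxt dx dxx : ℝ) : ℝ :=
  M * (x ^ 2 + x * xt + xx + xxt) + (x + xt + xx + xxt) * dx + dxx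

/-- The constant of `BoundedPair.gaugeBound_R_sub`, with the a priori bound for `ρt` inserted. The
only terms with `dρ` carry a factor `x` or `xx`, which is small. -/
lemma remainder_polynomial_le {A x xx xt xxt ρt dx dxx dρ M : ℝ} (hA : 1 ≤ A) (hx : 0 ≤ x)
    (hxx : 0 ≤ xx) (hxt : 0 ≤ xt) (hxxt : 0 ≤ xxt) (hρt : 0 ≤ ρt) (hdx : 0 ≤ dx) (hdxx : 0 ≤ dxx)
    (hdρ : 0 ≤ dρ) (hM : 0 ≤ M) (hx1 : x ≤ 1) (hxt1 : xt ≤ 1) (hxxt1 : xxt ≤ 1)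
    (hρ : ρt ≤ A * (xt ^ 2 + xxt)) :
    A ^ 2 * (M * xx + dxx)
        + A * ((A * dρ + A * (M + A * (M * x + dx)) * ρt
            + A ^ 3 * ((x + xt) * (M * x + dx) + M * xt ^ 2)) * x
          + (A * ρt + A ^ 3 * xt ^ 2) * dx
          + A ^ 2 * ((A * (M * x + dx) + dρ) + M * (A * xt + ρt)) * xx
          + A ^ 2 * (A * xt + ρt) * dxx)
      ≤ 19 * A ^ 4 * (lipschitzBound M x xx xt xxt dx dxx + (x + xx) * dρ) := by
  set τ := lipschitzBound M x xx xt xxt dx dxx + (x + xx) * dρ with hτ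
  have hτ' : τ = M * x ^ 2 + M * (x * xt) + M * xx + M * xxt + x * dx + xt * dx + xx * dx
      + xxt * dx + dxx + x * dρ + xx * dρ := by rw [hτ, lipschitzBound]; ring
  have n1 : 0 ≤ M * x ^ 2 := by positivity
  have n2 : 0 ≤ M * (x * xt) := by positivity
  have n3 : 0 ≤ M * xx := by positivity
  have n4 : 0 ≤ M * xxt := by positivity
  have n5 : 0 ≤ x * dx := by positivity
  have n6 : 0 ≤ xt * dx := by positivity
  have n7 : 0 ≤ xx * dx := by positivity
  have n8 : 0 ≤ xxt * dx := by positivity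
  have n9 : 0 ≤ x * dρ := by positivity
  have n10 : 0 ≤ xx * dρ := by positivity
  have hτ0 : 0 ≤ τ := by linarith
  have hA0 : 0 ≤ A := by linarith
  have p24 : A ^ 2 ≤ A ^ 4 := pow_le_pow_right₀ hA (by norm_num)
  have p34 : A ^ 3 ≤ A ^ 4 := pow_le_pow_right₀ hA (by norm_num)
  have hρ2 : ρt ≤ 2 * A := by
    have : xt ^ 2 ≤ 1 := pow_le_one₀ hxt hxt1
    calc ρt ≤ A * (1 + 1) := hρ.trans (by gcongr)
      _ = 2 * A := by ring
  have hAxt : A * xt ≤ A := mul_le_of_le_one_right hA0 hxt1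
  have q1 : x * (M * x + dx) ≤ τ := by linarith [show x * (M * x + dx) = M * x ^ 2 + x * dx by ring]
  have hMx : M * x ≤ M := mul_le_of_le_one_right hM hx1
  have t1 : A ^ 2 * (M * xx + dxx) ≤ A ^ 4 * τ := by gcongr; linarith
  have t2 : A ^ 2 * (x * dρ) ≤ A ^ 4 * τ := by gcongr; linarith
  have t3 : A ^ 2 * (M * (x * ρt)) ≤ A ^ 4 * τ := by
    have e : x * ρt ≤ A * (x * xt + xxt) := by
      calc x * ρt ≤ x * (A * (xt ^ 2 + xxt)) := by gcongr
        _ = A * (x * xt * xt + x * xxt) := by ring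
        _ ≤ A * (x * xt * 1 + 1 * xxt) := by gcongr
        _ = _ := by ring
    calc _ ≤ A ^ 2 * (M * (A * (x * xt + xxt))) := by gcongr
      _ = A ^ 3 * (M * (x * xt) + M * xxt) := by ring
      _ ≤ A ^ 4 * τ := by gcongr; linarith
  have t4 : A ^ 3 * ((x * (M * x + dx)) * ρt) ≤ 2 * (A ^ 4 * τ) := by
    calc _ ≤ A ^ 3 * (τ * (2 * A)) := by gcongr
      _ = _ := by ring
  have t5 : A ^ 4 * ((x + xt) * (x * (M * x + dx))) ≤ 2 * (A ^ 4 * τ) := by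
    calc _ ≤ A ^ 4 * ((1 + 1) * τ) := by gcongr
      _ = _ := by ring
  have t6 : A ^ 4 * (M * xt ^ 2 * x) ≤ A ^ 4 * τ := by
    gcongr
    calc _ = M * (x * xt) * xt := by ring
      _ ≤ M * (x * xt) := mul_le_of_le_one_right n2 hxt1
      _ ≤ τ := by linarith
  have t7 : A ^ 2 * (ρt * dx) ≤ A ^ 4 * τ := by
    have e : ρt ≤ A * (xt + xxt) := by
      calc ρt ≤ A * (xt * xt + xxt) := by rw [← sq]; exact hρ
        _ ≤ A * (xt * 1 + xxt) := by gcongr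
        _ = _ := by ring
    calc _ ≤ A ^ 2 * (A * (xt + xxt) * dx) := by gcongr
      _ = A ^ 3 * (xt * dx + xxt * dx) := by ring
      _ ≤ A ^ 4 * τ := by gcongr; linarith
  have t8 : A ^ 4 * (xt ^ 2 * dx) ≤ A ^ 4 * τ := by
    gcongr
    calc _ = xt * dx * xt := by ring
      _ ≤ xt * dx := mul_le_of_le_one_right n6 hxt1
      _ ≤ τ := by linarith
  have t9 : A ^ 4 * ((M * x + dx) * xx) ≤ A ^ 4 * τ := by
    gcongr
    calc _ ≤ (M + dx) * xx := by gcongr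
      _ = M * xx + xx * dx := by ring
      _ ≤ τ := by linarith
  have t10 : A ^ 3 * (dρ * xx) ≤ A ^ 4 * τ := by gcongr; linarith
  have t11 : A ^ 3 * (M * (A * xt + ρt) * xx) ≤ 3 * (A ^ 4 * τ) := by
    calc _ ≤ A ^ 3 * (M * (A + 2 * A) * xx) := by gcongr
      _ = 3 * (A ^ 4 * (M * xx)) := by ring
      _ ≤ _ := by gcongr; linarith
  have t12 : A ^ 3 * ((A * xt + ρt) * dxx) ≤ 3 * (A ^ 4 * τ) := by
    calc _ ≤ A ^ 3 * ((A + 2 * A) * dxx) := by gcongr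
      _ = 3 * (A ^ 4 * dxx) := by ring
      _ ≤ _ := by gcongr; linarith
  have n0 : 0 ≤ A ^ 4 * τ := by positivity
  linarith

variable {φ : F → E →L[ℝ] F} {A : ℝ} {I : Set ℝ}
  {y₀ yt₀ : F} {bX bXt : RoughPath N r T} {bY : ControlledPath bX F} {bYt : ControlledPath bXt F}

/-- The factor `9` is the number of functions that share the gauge. -/
lemma exists_boundedPair (h2 : 2 ≤ r) (hIT : I ⊆ Set.Icc 0 T)
    (hsol : IsSolution φ y₀ bY) (hsolt : IsSolution φ yt₀ bYt) {M : ℝ} (hM0 : 0 ≤ M)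
    (hM : ∀ s ∈ I, ‖bY.Y s - bYt.Y s‖ ≤ M) :
    ∃ h, IsGauge r h I ∧
      BoundedPair φ h I y₀ yt₀ bY bYt (9 * bX.varX I) (9 * bX.varXX I) (9 * bY.varR I)
        (9 * bXt.varX I) (9 * bXt.varXX I) (9 * bYt.varR I) (9 * bX.varXSub bXt I)
        (9 * bX.varXXSub bXt I) (9 * bY.varRSub bYt I) M := by
  obtain ⟨h, H, hle⟩ := exists_gauge (ι := Fin 9) (r := r) (by linarith)
    ![1, 2, 2, 1, 2, 2, 1, 2, 2]
    (by intro k; fin_cases k <;> norm_num)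
    (by intro k; fin_cases k <;> norm_num <;> linarith)
    ![fun s t => ‖bX.X s t‖, fun s t => N.toSeminorm (bX.XX s t), fun s t => ‖bY.R s t‖,
      fun s t => ‖bXt.X s t‖, fun s t => N.toSeminorm (bXt.XX s t), fun s t => ‖bYt.R s t‖,
      fun s t => ‖bX.X s t - bXt.X s t‖, fun s t => N.toSeminorm (bX.XX s t - bXt.XX s t),
      fun s t => ‖bY.R s t - bYt.R s t‖] I
    (by
      intro k s hs
      fin_cases k <;> simp [bX.X_self (hIT hs), bX.XX_self (hIT hs), bY.R_self (hIT hs),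
        bXt.X_self (hIT hs), bXt.XX_self (hIT hs), bYt.R_self (hIT hs)])
    (by
      intro k
      fin_cases k
      · exact bX.finiteVariation_X.mono hIT
      · exact bX.finiteVariation_XX.mono hIT
      · exact bY.finiteVariation_R.mono hIT
      · exact bXt.finiteVariation_X.mono hIT
      · exact bXt.finiteVariation_XX.mono hIT
      · exact bYt.finiteVariation_R.mono hIT
      · exact (bX.finiteVariation_X_sub h2 bXt).mono hIT
      · exact (bX.finiteVariation_XX_sub h2 bXt).mono hIT
      · exact (bY.finiteVariation_R_sub h2 bYt).mono hIT)
  have e : (Fintype.card (Fin 9) : ℝ) = 9 := by simp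
  rw [e] at hle
  have nn : ∀ m q, 0 ≤ 9 * realVariation r m q I := fun m q =>
    mul_nonneg (by norm_num) (realVariation_nonneg _ _ _ _)
  exact ⟨h, H, ⟨hsol, nn _ _, nn _ _, nn _ _, hle 0, hle 1, hle 2⟩,
    ⟨hsolt, nn _ _, nn _ _, nn _ _, hle 3, hle 4, hle 5⟩, nn _ _, nn _ _, nn _ _, hM0,
    hle 6, hle 7, hle 8, hM⟩

/-- All variations of the data over `I` are at most `δ`. -/
structure SmallData (bX bXt : RoughPath N r T) (I : Set ℝ) (δ : ℝ) : Prop where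
  X_le : bX.varX I ≤ δ
  XX_le : bX.varXX I ≤ δ
  Xt_le : bXt.varX I ≤ δ
  XXt_le : bXt.varXX I ≤ δ

/-- The estimate of the difference of two solutions over `I` in terms of a bound `M` for their
distance on `I`. -/
lemma variation_sub_le (h2 : 2 ≤ r) (hD : Dominates N r φ A) (hI : I.OrdConnected)
    (hIT : I ⊆ Set.Icc 0 T) (hsol : IsSolution φ y₀ bY) (hsolt : IsSolution φ yt₀ bYt) {M : ℝ}
    (hM0 : 0 ≤ M) (hM : ∀ s ∈ I, ‖bY.Y s - bYt.Y s‖ ≤ M)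
    (hsmall : SmallData bX bXt I (1 / (6156 * A ^ 4)))
    (hRt : 9 * bYt.varR I ≤ A * ((9 * bXt.varX I) ^ 2 + 9 * bXt.varXX I)) :
    normVariation (r / 2) (bY.R - bYt.R) I ≤ ENNReal.ofReal (3078 * A ^ 4 *
        lipschitzBound M (bX.varX I) (bX.varXX I) (bXt.varX I) (bXt.varXX I)
          (bX.varXSub bXt I) (bX.varXXSub bXt I)) ∧
      pathVariation r (bY.Y - bYt.Y) I ≤ ENNReal.ofReal (138510 * A ^ 4 *
        ((bX.varX I + bX.varXX I + bXt.varXX I) * M + bX.varXSub bXt I + bX.varXXSub bXt I)) ∧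
      ∀ s ∈ I, ∀ t ∈ I, s ≤ t → ‖(bY.Y t - bY.Y s) - (bYt.Y t - bYt.Y s)‖ ≤ 138510 * A ^ 4 *
        ((bX.varX I + bX.varXX I + bXt.varXX I) * M + bX.varXSub bXt I + bX.varXXSub bXt I) := by
  obtain ⟨h, H, S⟩ := exists_boundedPair h2 hIT hsol hsolt hM0 hM
  have hA := hD.regular.one_le
  have hA4 : 1 ≤ A ^ 4 := one_le_pow₀ hA
  have hAA : A ≤ A ^ 4 := le_self_pow₀ hA (by norm_num)
  have hR := S.gaugeBound_R_sub hD hI hIT H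
  have hY : ∀ s ∈ I, ∀ t ∈ I, s ≤ t → _ := fun s hs t ht hst =>
    S.norm_increment_sub_le hD hIT H hs ht hst
  have hX1 := hsmall.X_le
  have hXX1 := hsmall.XX_le
  have hXt1 := hsmall.Xt_le
  have hXXt1 := hsmall.XXt_le
  have hx : 0 ≤ bX.varX I := realVariation_nonneg _ _ _ _
  have hxx : 0 ≤ bX.varXX I := realVariation_nonneg _ _ _ _
  have hxt : 0 ≤ bXt.varX I := realVariation_nonneg _ _ _ _
  have hxxt : 0 ≤ bXt.varXX I := realVariation_nonneg _ _ _ _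
  have hρt : 0 ≤ bYt.varR I := realVariation_nonneg _ _ _ _
  have hdx : 0 ≤ bX.varXSub bXt I := realVariation_nonneg _ _ _ _
  have hdxx : 0 ≤ bX.varXXSub bXt I := realVariation_nonneg _ _ _ _
  have hdρ : 0 ≤ bY.varRSub bYt I := realVariation_nonneg _ _ _ _
  have hdR : ∀ c, 0 ≤ c → GaugeBound h I (fun s t => ‖bY.R s t - bYt.R s t‖) c 2 →
      bY.varRSub bYt I ≤ c := fun c hc => H.realVariation_le hD.r_pos two_pos hc
  have hdRfin : normVariation (r / 2) (bY.R - bYt.R) I = ENNReal.ofReal (bY.varRSub bYt I) := by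
    rw [normVariation_eq_two]
    exact (ENNReal.ofReal_toReal ((bY.finiteVariation_R_sub h2 bYt).mono hIT).ne).symm
  rw [hdRfin]
  clear S hdRfin hsmall
  revert hR hY hX1 hXX1 hXt1 hXXt1 hx hxx hxt hxxt hρt hdx hdxx hdρ hdR hRt
  generalize bX.varX I = x
  generalize bX.varXX I = xx
  generalize bXt.varX I = xt
  generalize bXt.varXX I = xxt
  generalize bYt.varR I = ρt
  generalize bX.varXSub bXt I = dx
  generalize bX.varXXSub bXt I = dxx
  generalize bY.varRSub bYt I = dρ
  intro hRt hR hY hX1 hXX1 hXt1 hXXt1 hx hxx hxt hxxt hρt hdx hdxx hdρ hdR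
  rw [le_div_iff₀ (by positivity)] at hX1 hXX1 hXt1 hXXt1
  have hx1 : 9 * x ≤ 1 := by nlinarith
  have hxx1 : 9 * xx ≤ 1 := by nlinarith
  have hxt1 : 9 * xt ≤ 1 := by nlinarith
  have hxxt1 : 9 * xxt ≤ 1 := by nlinarith
  have hpoly := (hdR _ (by positivity) hR).trans (remainder_polynomial_le hA (by positivity)
    (by positivity) (by positivity) (by positivity) (by positivity) (by positivity) (by positivity)
    (by positivity) hM0 hx1 hxt1 hxxt1 hRt)
  -- the smallness of the data allows to absorb the term with `dρ` into the left-hand side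
  have habs : 19 * A ^ 4 * ((9 * x + 9 * xx) * (9 * dρ)) ≤ dρ / 2 := by
    have : (6156 * A ^ 4 * (x + xx)) * dρ ≤ 2 * dρ := by gcongr; linarith
    linarith
  have hscale : lipschitzBound M (9 * x) (9 * xx) (9 * xt) (9 * xxt) (9 * dx) (9 * dxx)
      ≤ 81 * lipschitzBound M x xx xt xxt dx dxx := by
    have : 0 ≤ 72 * (M * (xx + xxt) + dxx) := by positivity
    unfold lipschitzBound
    linarith
  have hfin : dρ ≤ 3078 * A ^ 4 * lipschitzBound M x xx xt xxt dx dxx := by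
    have : 19 * A ^ 4 * lipschitzBound M (9 * x) (9 * xx) (9 * xt) (9 * xxt) (9 * dx) (9 * dxx)
        ≤ 19 * A ^ 4 * (81 * lipschitzBound M x xx xt xxt dx dxx) := by gcongr
    linarith
  have hτ : lipschitzBound M x xx xt xxt dx dxx
      ≤ 2 * (M * x) + M * xx + M * xxt + 4 * dx + dxx := by
    have e1 : M * x * x ≤ M * x * 1 := by gcongr; linarith
    have e2 : M * x * xt ≤ M * x * 1 := by gcongr; linarith
    have e3 : (x + xt + xx + xxt) * dx ≤ 4 * dx := by gcongr; linarith
    unfold lipschitzBound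
    linarith
  have hmain : A * (M * (9 * x) + 9 * dx) + 9 * dρ
      ≤ 138510 * A ^ 4 * ((x + xx + xxt) * M + dx + dxx) := by
    have e1 : A * (9 * (M * x + dx)) ≤ A ^ 4 * (9 * (M * x + dx)) := by gcongr
    have e2 : 3078 * A ^ 4 * lipschitzBound M x xx xt xxt dx dxx
        ≤ 3078 * A ^ 4 * (2 * (M * x) + M * xx + M * xxt + 4 * dx + dxx) := by gcongr
    have n1 : 0 ≤ A ^ 4 * (M * x) := by positivity
    have n2 : 0 ≤ A ^ 4 * (M * xx) := by positivity
    have n3 : 0 ≤ A ^ 4 * (M * xxt) := by positivity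
    have n4 : 0 ≤ A ^ 4 * dx := by positivity
    have n5 : 0 ≤ A ^ 4 * dxx := by positivity
    linarith
  refine ⟨ENNReal.ofReal_le_ofReal hfin, ?_, fun s hs t ht hst => ?_⟩
  · have := H.variation_le_of_gaugeBound hD.r_pos one_pos
      (C := 138510 * A ^ 4 * ((x + xx + xxt) * M + dx + dxx)) (by positivity)
      (q := fun s t => ‖(bY.Y t - bY.Y s) - (bYt.Y t - bYt.Y s)‖) fun s hs t ht hst => by
        have h1 := H.nonneg s t
        rw [pow_one]
        exact (hY s hs t ht hst).trans (by gcongr)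
    have e : pathVariation r (bY.Y - bYt.Y) I = variation (r / (1 : ℕ))
        (fun s t => ENNReal.ofReal ‖(bY.Y t - bY.Y s) - (bYt.Y t - bYt.Y s)‖) I := by
      simp only [pathVariation, Pi.sub_apply, Nat.cast_one, div_one, ofReal_norm]
      congr with s t
      rw [sub_sub_sub_comm]
    rwa [e]
  · refine (hY s hs t ht hst).trans ((mul_le_of_le_one_right (by positivity)
      (H.le_one s hs t ht hst)).trans hmain)

lemma ofReal_le_path_bound {V₁ V₂ V₃ γ D₁ D₂ : ℝ≥0∞} {c : ℝ≥0} (h₁ : V₁ ≠ ∞) (h₂ : V₂ ≠ ∞)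
    (h₃ : V₃ ≠ ∞) (hγ : γ ≠ ∞) (hD₁ : D₁ ≠ ∞) (hD₂ : D₂ ≠ ∞) {b : ℝ}
    (hb : b ≤ c * ((V₁.toReal + V₂.toReal + V₃.toReal) * γ.toReal + D₁.toReal + D₂.toReal)) :
    ENNReal.ofReal b ≤ c * ((V₁ + V₂ + V₃) * γ + D₁ + D₂) := by
  lift V₁ to ℝ≥0 using h₁
  lift V₂ to ℝ≥0 using h₂
  lift V₃ to ℝ≥0 using h₃
  lift γ to ℝ≥0 using hγ
  lift D₁ to ℝ≥0 using hD₁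
  lift D₂ to ℝ≥0 using hD₂
  refine ENNReal.ofReal_le_of_le_toReal ?_
  exact_mod_cast hb

lemma ofReal_le_remainder_bound {V₁ V₂ V₃ V₄ γ D₁ D₂ : ℝ≥0∞} {c : ℝ≥0} (h₁ : V₁ ≠ ∞)
    (h₂ : V₂ ≠ ∞) (h₃ : V₃ ≠ ∞) (h₄ : V₄ ≠ ∞) (hγ : γ ≠ ∞) (hD₁ : D₁ ≠ ∞) (hD₂ : D₂ ≠ ∞) {b : ℝ}
    (hb : b ≤ c * ((V₁.toReal ^ 2 + V₁.toReal * V₃.toReal + V₂.toReal + V₄.toReal) * γ.toReal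
      + (V₁.toReal + V₃.toReal + V₂.toReal + V₄.toReal) * D₁.toReal + D₂.toReal)) :
    ENNReal.ofReal b
      ≤ c * ((V₁ ^ 2 + V₁ * V₃ + V₂ + V₄) * γ + (V₁ + V₃ + V₂ + V₄) * D₁ + D₂) := by
  lift V₁ to ℝ≥0 using h₁
  lift V₂ to ℝ≥0 using h₂
  lift V₃ to ℝ≥0 using h₃
  lift V₄ to ℝ≥0 using h₄
  lift γ to ℝ≥0 using hγ
  lift D₁ to ℝ≥0 using hD₁
  lift D₂ to ℝ≥0 using hD₂
  refine ENNReal.ofReal_le_of_le_toReal ?_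
  exact_mod_cast hb

/-- The estimate over the whole interval bounds the distance of the solutions by the distance of
the data: as the coefficient of the distance is small, it is absorbed into the left-hand side. -/
lemma norm_sub_le_of_smallData (h2 : 2 ≤ r) (hT : 0 ≤ T) (hD : Dominates N r φ A)
    (hsol : IsSolution φ y₀ bY) (hsolt : IsSolution φ yt₀ bYt)
    (hsmall : SmallData bX bXt (Set.Icc 0 T) (1 / (831060 * A ^ 4)))
    (hRt : 9 * bYt.varR (Set.Icc 0 T)
      ≤ A * ((9 * bXt.varX (Set.Icc 0 T)) ^ 2 + 9 * bXt.varXX (Set.Icc 0 T))) :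
    ∀ t ∈ Set.Icc 0 T, ‖bY.Y t - bYt.Y t‖ ≤ 277020 * A ^ 4 *
      (‖y₀ - yt₀‖ + bX.varXSub bXt (Set.Icc 0 T) + bX.varXXSub bXt (Set.Icc 0 T)) := by
  have hA := hD.regular.one_le
  have hA4 : 1 ≤ A ^ 4 := one_le_pow₀ hA
  have h0 : (0 : ℝ) ∈ Set.Icc 0 T := ⟨le_rfl, hT⟩
  obtain ⟨K, hK⟩ := hsol.exists_norm_le h2 hT hD
  obtain ⟨Kt, hKt⟩ := hsolt.exists_norm_le h2 hT hD
  set D : Set ℝ := (fun t => ‖bY.Y t - bYt.Y t‖) '' Set.Icc 0 T with hDdef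
  have hbdd : BddAbove D := by
    refine ⟨K + Kt, ?_⟩
    rintro _ ⟨t, ht, rfl⟩
    exact (norm_sub_le _ _).trans (add_le_add (hK t ht) (hKt t ht))
  have hne : D.Nonempty := ⟨_, 0, h0, rfl⟩
  have hM : ∀ t ∈ Set.Icc 0 T, ‖bY.Y t - bYt.Y t‖ ≤ sSup D := fun t ht =>
    le_csSup hbdd ⟨t, ht, rfl⟩
  have hM0 : 0 ≤ sSup D := (norm_nonneg _).trans (hM 0 h0)
  have hδ : 1 / (831060 * A ^ 4) ≤ 1 / (6156 * A ^ 4) := by gcongr; norm_num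
  have key := (variation_sub_le h2 hD Set.ordConnected_Icc subset_rfl hsol hsolt hM0 hM
    ⟨hsmall.X_le.trans hδ, hsmall.XX_le.trans hδ, hsmall.Xt_le.trans hδ, hsmall.XXt_le.trans hδ⟩
    hRt).2.2
  have hdx : 0 ≤ bX.varXSub bXt (Set.Icc 0 T) := realVariation_nonneg _ _ _ _
  have hdxx : 0 ≤ bX.varXXSub bXt (Set.Icc 0 T) := realVariation_nonneg _ _ _ _
  have s1 := hsmall.X_le
  have s2 := hsmall.XX_le
  have s3 := hsmall.XXt_le
  rw [le_div_iff₀ (by positivity)] at s1 s2 s3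
  have habs : 138510 * A ^ 4 * ((bX.varX (Set.Icc 0 T) + bX.varXX (Set.Icc 0 T)
      + bXt.varXX (Set.Icc 0 T)) * sSup D) ≤ sSup D / 2 := by
    have : (831060 * A ^ 4 * (bX.varX (Set.Icc 0 T) + bX.varXX (Set.Icc 0 T)
      + bXt.varXX (Set.Icc 0 T))) * sSup D ≤ 3 * sSup D := by gcongr; linarith
    linarith
  have hstep : ∀ t ∈ Set.Icc 0 T, ‖bY.Y t - bYt.Y t‖ ≤ sSup D / 2 + 138510 * A ^ 4 *
      (‖y₀ - yt₀‖ + bX.varXSub bXt (Set.Icc 0 T) + bX.varXXSub bXt (Set.Icc 0 T)) := by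
    intro t ht
    have h1 := key 0 h0 t ht ht.1
    rw [hsol.Y_zero hT, hsolt.Y_zero hT] at h1
    have h3 := norm_add_le (bY.Y t - y₀ - (bYt.Y t - yt₀)) (y₀ - yt₀)
    rw [show bY.Y t - y₀ - (bYt.Y t - yt₀) + (y₀ - yt₀) = bY.Y t - bYt.Y t by abel] at h3
    have h4 : ‖y₀ - yt₀‖ ≤ 138510 * A ^ 4 * ‖y₀ - yt₀‖ :=
      le_mul_of_one_le_left (norm_nonneg _) (by linarith)
    linarith
  have hsup : sSup D ≤ sSup D / 2 + 138510 * A ^ 4 *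
      (‖y₀ - yt₀‖ + bX.varXSub bXt (Set.Icc 0 T) + bX.varXXSub bXt (Set.Icc 0 T)) := by
    refine csSup_le hne ?_
    rintro _ ⟨t, ht, rfl⟩
    exact hstep t ht
  intro t ht
  linarith [hM t ht]

lemma exists_dominates [FiniteDimensional ℝ E] (N : CompatibleNorm E) (hr : r ∈ Set.Ico (2 : ℝ) 3)
    {φ : F → E →L[ℝ] F} (hφ : IsC21b φ) : ∃ A, Dominates N r φ A := by
  obtain ⟨A, hA⟩ := hφ.exists_isRegular
  obtain ⟨κ, hκ⟩ := exists_norm_tensorAct_le (F := F) N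
  refine ⟨max A (max κ (sewingConst r)), by linarith [hr.1], hr.2, hA.mono (le_max_left _ _),
    fun B ξ => (hκ B ξ).trans ?_, by simp⟩
  have : κ ≤ max A (max κ (sewingConst r)) := by simp
  have := apply_nonneg N.toSeminorm ξ
  gcongr

lemma Dominates.mono (hD : Dominates N r φ A) {B : ℝ} (hAB : A ≤ B) : Dominates N r φ B :=
  ⟨hD.r_pos, hD.r_lt, hD.regular.mono hAB, fun C ξ => (hD.tensorAct_le C ξ).trans (by
    have := apply_nonneg N.toSeminorm ξ
    gcongr), hD.sewing_le.trans hAB⟩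

end RDE

theorem mainTheorem6
    {E : Type*} [NormedAddCommGroup E] [NormedSpace ℝ E] [FiniteDimensional ℝ E]
    {F : Type*} [NormedAddCommGroup F] [NormedSpace ℝ F] [CompleteSpace F]
    (N : RDE.CompatibleNorm E) (r : ℝ) (hr : r ∈ Set.Ico (2 : ℝ) 3)
    (φ : F → E →L[ℝ] F) (hφ : RDE.IsC21b φ) :
    ∃ ε > (0 : ℝ≥0), ∃ c₁ c₂ : ℝ≥0, ∀ (T : ℝ), 0 ≤ T →
      ∀ (bX bXt : RDE.RoughPath N r T),
        RDE.normVariation r bX.X (Set.Icc 0 T) < ε →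
        RDE.tensorVariation N (r / 2) bX.XX (Set.Icc 0 T) < ε →
        RDE.normVariation r bXt.X (Set.Icc 0 T) < ε →
        RDE.tensorVariation N (r / 2) bXt.XX (Set.Icc 0 T) < ε →
      ∀ (y₀ yt₀ : F) (bY : RDE.ControlledPath bX F) (bYt : RDE.ControlledPath bXt F),
        RDE.IsSolution φ y₀ bY → RDE.IsSolution φ yt₀ bYt →
      ∀ I : Set ℝ, I.OrdConnected → I ⊆ Set.Icc 0 T →
        let VX : ℝ≥0∞ := RDE.normVariation r bX.X I
        let VXX : ℝ≥0∞ := RDE.tensorVariation N (r / 2) bX.XX I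
        let VXt : ℝ≥0∞ := RDE.normVariation r bXt.X I
        let VXXt : ℝ≥0∞ := RDE.tensorVariation N (r / 2) bXt.XX I
        let VΔX : Set ℝ → ℝ≥0∞ := RDE.normVariation r (bX.X - bXt.X)
        let VΔXX : Set ℝ → ℝ≥0∞ := RDE.tensorVariation N (r / 2) (bX.XX - bXt.XX)
        let γ : ℝ≥0∞ := ‖y₀ - yt₀‖ₑ + VΔX (Set.Icc 0 T) + VΔXX (Set.Icc 0 T)
        RDE.pathVariation r (bY.Y - bYt.Y) I
            ≤ c₁ * ((VX + VXX + VXXt) * γ + VΔX I + VΔXX I) ∧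
          RDE.normVariation (r / 2) (bY.R - bYt.R) I
            ≤ c₂ * ((VX ^ 2 + VX * VXt + VXX + VXXt) * γ
                + (VX + VXt + VXX + VXXt) * VΔX I + VΔXX I) := by
  have h2 := hr.1
  obtain ⟨A, hA⟩ := RDE.exists_dominates N hr hφ
  have hA1 := hA.regular.one_le
  -- the constant `B` also dominates the constant of the a priori bound
  set B := 36 * A ^ 4 with hB
  have hAA : A ≤ A ^ 4 := le_self_pow₀ hA1 (by norm_num)
  have hAB : A ≤ B := by linarith
  have hB1 : 1 ≤ B := hA1.trans hAB
  have hBD : RDE.Dominates N r φ B := hA.mono hAB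
  have hB4 : 1 ≤ B ^ 4 := one_le_pow₀ hB1
  set C := 277020 * B ^ 4 with hC
  have hC1 : 1 ≤ C := by linarith
  have hδ1 : 1 / (831060 * B ^ 4) ≤ 1 / (36 * A ^ 3) := by
    have : A ^ 3 ≤ B ^ 4 := (pow_le_pow_left₀ (by linarith) hAB 3).trans
      (pow_le_pow_right₀ hB1 (by norm_num))
    gcongr
    norm_num
  have hδ2 : 1 / (831060 * B ^ 4) ≤ 1 / (6156 * B ^ 4) := by gcongr; norm_num
  refine ⟨Real.toNNReal (1 / (831060 * B ^ 4)), Real.toNNReal_pos.2 (by positivity),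
    Real.toNNReal (C * C), Real.toNNReal (C * C), ?_⟩
  intro T hT bX bXt hX hXX hXt hXXt y₀ yt₀ bY bYt hsol hsolt I hI hIT
  have hδ0 : 0 ≤ 1 / (831060 * B ^ 4) := by positivity
  have toReal_le : ∀ V : ℝ≥0∞, V < (Real.toNNReal (1 / (831060 * B ^ 4)) : ℝ≥0) →
      V.toReal ≤ 1 / (831060 * B ^ 4) := fun V hV =>
    ENNReal.toReal_le_of_le_ofReal hδ0 hV.le
  have eX : ∀ (b : RDE.RoughPath N r T) (J : Set ℝ),
      (RDE.normVariation r b.X J).toReal = b.varX J := fun b J => by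
    rw [RDE.normVariation_eq_one]; rfl
  have eXX : ∀ (b : RDE.RoughPath N r T) (J : Set ℝ),
      (RDE.tensorVariation N (r / 2) b.XX J).toReal = b.varXX J := fun b J => by
    simp [RDE.tensorVariation, RDE.RoughPath.varXX, RDE.realVariation]
  have edX : ∀ J, (RDE.normVariation r (bX.X - bXt.X) J).toReal = bX.varXSub bXt J := fun J => by
    rw [RDE.normVariation_eq_one]; rfl
  have edXX : ∀ J, (RDE.tensorVariation N (r / 2) (bX.XX - bXt.XX) J).toReal
      = bX.varXXSub bXt J := fun J => by
    simp [RDE.tensorVariation, RDE.RoughPath.varXXSub, RDE.realVariation]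
  have fX : ∀ (b : RDE.RoughPath N r T) (J : Set ℝ), J ⊆ Set.Icc 0 T →
      RDE.normVariation r b.X J ≠ ∞ := fun b J hJ =>
    ((RDE.variation_mono _ _ hJ).trans_lt b.variation_X).ne
  have fXX : ∀ (b : RDE.RoughPath N r T) (J : Set ℝ), J ⊆ Set.Icc 0 T →
      RDE.tensorVariation N (r / 2) b.XX J ≠ ∞ := fun b J hJ =>
    ((RDE.variation_mono _ _ hJ).trans_lt b.variation_XX).ne
  have fdX : ∀ J ⊆ Set.Icc 0 T, RDE.normVariation r (bX.X - bXt.X) J ≠ ∞ := fun J hJ => by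
    rw [RDE.normVariation_eq_one]
    exact ((bX.finiteVariation_X_sub h2 bXt).mono hJ).ne
  have fdXX : ∀ J ⊆ Set.Icc 0 T, RDE.tensorVariation N (r / 2) (bX.XX - bXt.XX) J ≠ ∞ := by
    intro J hJ
    have := ((bX.finiteVariation_XX_sub h2 bXt).mono hJ).ne
    simpa [RDE.tensorVariation] using this
  have small : ∀ J ⊆ Set.Icc 0 T, RDE.SmallData bX bXt J (1 / (831060 * B ^ 4)) := fun J hJ =>
    ⟨(bX.finiteVariation_X.realVariation_mono hJ).trans ((eX _ _).symm.trans_le (toReal_le _ hX)),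
      (bX.finiteVariation_XX.realVariation_mono hJ).trans
        ((eXX _ _).symm.trans_le (toReal_le _ hXX)),
      (bXt.finiteVariation_X.realVariation_mono hJ).trans
        ((eX _ _).symm.trans_le (toReal_le _ hXt)),
      (bXt.finiteVariation_XX.realVariation_mono hJ).trans
        ((eXX _ _).symm.trans_le (toReal_le _ hXXt))⟩
  have apriori : ∀ J ⊆ Set.Icc 0 T, J.OrdConnected →
      9 * bYt.varR J ≤ B * ((9 * bXt.varX J) ^ 2 + 9 * bXt.varXX J) := by
    intro J hJ hJc
    have h1 := hsolt.varR_le h2 hA hJc hJ ((small J hJ).Xt_le.trans hδ1)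
      ((small J hJ).XXt_le.trans hδ1)
    rw [← hB] at h1
    have : 0 ≤ B * bXt.varX J ^ 2 := by positivity
    linarith
  have hM := RDE.norm_sub_le_of_smallData h2 hT hBD hsol hsolt (small _ subset_rfl)
    (apriori _ subset_rfl Set.ordConnected_Icc)
  rw [← hC] at hM
  have hγ0 : 0 ≤ ‖y₀ - yt₀‖ + bX.varXSub bXt (Set.Icc 0 T) + bX.varXXSub bXt (Set.Icc 0 T) :=
    add_nonneg (add_nonneg (norm_nonneg _) (RDE.realVariation_nonneg _ _ _ _))
      (RDE.realVariation_nonneg _ _ _ _)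
  obtain ⟨hR, hY, -⟩ := RDE.variation_sub_le h2 hBD hI hIT hsol hsolt
    (mul_nonneg (by linarith) hγ0) (fun s hs => hM s (hIT hs))
    ⟨(small I hIT).X_le.trans hδ2, (small I hIT).XX_le.trans hδ2, (small I hIT).Xt_le.trans hδ2,
      (small I hIT).XXt_le.trans hδ2⟩ (apriori I hIT hI)
  intro VX VXX VXt VXXt VΔX VΔXX γ
  have hγfin : γ ≠ ∞ := ENNReal.add_ne_top.2 ⟨ENNReal.add_ne_top.2
    ⟨enorm_ne_top, fdX _ subset_rfl⟩, fdXX _ subset_rfl⟩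
  have hγ : γ.toReal
      = ‖y₀ - yt₀‖ + bX.varXSub bXt (Set.Icc 0 T) + bX.varXXSub bXt (Set.Icc 0 T) := by
    rw [ENNReal.toReal_add (ENNReal.add_ne_top.2 ⟨enorm_ne_top, fdX _ subset_rfl⟩)
      (fdXX _ subset_rfl), ENNReal.toReal_add enorm_ne_top (fdX _ subset_rfl), edX, edXX,
      toReal_enorm]
  have hCC : ((Real.toNNReal (C * C) : ℝ≥0) : ℝ) = C * C := Real.coe_toNNReal _ (by positivity)
  have hx : 0 ≤ bX.varX I := RDE.realVariation_nonneg _ _ _ _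
  have hxx : 0 ≤ bX.varXX I := RDE.realVariation_nonneg _ _ _ _
  have hxt : 0 ≤ bXt.varX I := RDE.realVariation_nonneg _ _ _ _
  have hxxt : 0 ≤ bXt.varXX I := RDE.realVariation_nonneg _ _ _ _
  have hdx : 0 ≤ bX.varXSub bXt I := RDE.realVariation_nonneg _ _ _ _
  have hdxx : 0 ≤ bX.varXXSub bXt I := RDE.realVariation_nonneg _ _ _ _
  -- a factor `C ≥ 1` is lost on the terms without `γ`, so that one constant serves for all
  have enlarge : ∀ a b g : ℝ, 0 ≤ a → 0 ≤ b → 0 ≤ g → ∀ c ≤ C, 0 ≤ c →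
      c * (a * (C * g) + b) ≤ C * C * (a * g + b) := by
    intro a b g ha hb hg c hc hc0
    calc c * (a * (C * g) + b) ≤ C * (a * (C * g) + C * b) := by
          have : b ≤ C * b := le_mul_of_one_le_left hb hC1
          gcongr
      _ = _ := by ring
  refine ⟨hY.trans (RDE.ofReal_le_path_bound (fX _ _ hIT) (fXX _ _ hIT) (fXX _ _ hIT) hγfin
      (fdX _ hIT) (fdXX _ hIT) ?_),
    hR.trans (RDE.ofReal_le_remainder_bound (fX _ _ hIT) (fXX _ _ hIT) (fX _ _ hIT) (fXX _ _ hIT)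
      hγfin (fdX _ hIT) (fdXX _ hIT) ?_)⟩
  · rw [hCC, hγ, eX, eXX, eXX, edX, edXX, add_assoc, add_assoc (_ * (_ + _ + _))]
    exact enlarge _ _ _ (by positivity) (by positivity) hγ0 _ (by linarith) (by positivity)
  · rw [hCC, hγ, eX, eXX, eX, eXX, edX, edXX, RDE.lipschitzBound]
    refine le_trans (le_of_eq ?_) ((enlarge (bX.varX I ^ 2 + bX.varX I * bXt.varX I + bX.varXX I
      + bXt.varXX I) ((bX.varX I + bXt.varX I + bX.varXX I + bXt.varXX I) * bX.varXSub bXt I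
        + bX.varXXSub bXt I) _ (by positivity) (by positivity) hγ0 (3078 * B ^ 4) (by linarith)
      (by positivity)).trans (le_of_eq ?_)) <;> ring
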